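/- Let $\mathfrak g=\mathfrak{sp}(\infty)=\varinjlim \mathfrak{sp}(2n)$ over $\mathbb C$, with Cartan subalgebra $\mathfrak h=\varinjlim\mathfrak h_n$, so that $\mathfrak h^*$ is identified with $\mathbb C^{\mathbb Z_{>0}}$, and the roots are $\Delta=\{\pm 2\varepsilon_i,\ \pm\varepsilon_i\pm\varepsilon_j \mid i\ne j\}$, where $\varepsilon_i$ is the sequence with $1$ in position $i$ and $0$ elsewhere. Let $Q$ be the root lattice. *The modules $X_{\mathfrak{sp}}(\mu)$.* For $\mu\in\mathbb C^{\mathbb Z_{>0}}$ let $\mathrm{Int}^+(\mu)=\{i\mid \mu_i\in\mathbb Z_{\ge 0}\}$, and write $\lambda\sim_{\mathfrak{sp}}\mu$ if $\lambda-\mu\in Q$ and $\mathrm{Int}^+(\lambda)=\mathrm{Int}^+(\mu)$. Let suitable root vectors of weights $\varepsilon_i-\varepsilon_j$, $\varepsilon_i+\varepsilon_j$, $2\varepsilon_i$, $-\varepsilon_i-\varepsilon_j$, $-2\varepsilon_i$ ($i\neq j$) act on formal monomials ${\bf x}^\lambda=\prod_i x_i^{\lambda_i}$, $\lambda\in\mathbb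 C^{\mathbb Z_{>0}}$, by $x_i\partial_j$, $x_ix_j$, $\tfrac12x_i^2$, $-\partial_i\partial_j$, $-\tfrac12\partial_i^2$, respectively. Put $V_{\mathfrak{sp}}(\mu)=\mathrm{Span}\{{\bf x}^\lambda\mid\lambda-\mu\in Q,\ \mathrm{Int}^+(\mu)\subseteq \mathrm{Int}^+(\lambda)\}$, let $V_{\mathfrak{sp}}(\mu)^+$ be the sum of all $V_{\mathfrak{sp}}(\mu')\subsetneq V_{\mathfrak{sp}}(\mu)$, and $X_{\mathfrak{sp}}(\mu)=V_{\mathfrak{sp}}(\mu)/V_{\mathfrak{sp}}(\mu)^+$. *Orders and parabolic subalgebras.* Let $\prec$ be a (strict) partial order on $\mathbb Z$ that is $\mathbb Z_2$-linear, i.e. $i\prec j$ implies $-j\prec -i$. Let $[i]$ be the set consisting of $i$ and all elements not comparable with $i$, and assume that $\prec$ is admissible: $[i]\neq[j]$ implies $[i]\cap[j]=\emptyset$. For subsets, $A\prec B$ means $a\prec b$ for all $a\in A$, $b\in B$; this gives a linear order on the set of blocks $[i]$. Put $$P^+=\{2\varepsilon_i\mid i\prec 0\}\cup\{-2\varepsilon_i\mid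 -i\prec 0\}\cup\{\varepsilon_i-\varepsilon_j\mid i\prec j\}\cup\{\varepsilon_i+\varepsilon_j\mid i\prec -j\}\cup\{-\varepsilon_i-\varepsilon_j\mid -i\prec j\}$$ ($i,j\in\mathbb Z_{>0}$) and $P^0=\Delta\setminus(P^+\cup -P^+)$. Let $\mathfrak p(\prec)=\mathfrak l(\prec)\oplus\mathfrak u(\prec)$ be the parabolic subalgebra with $\mathfrak l(\prec)=\mathfrak h\oplus\bigoplus_{\alpha\in P^0}\mathfrak g_\alpha$ and $\mathfrak u(\prec)=\bigoplus_{\alpha\in P^+}\mathfrak g_\alpha$. All weight modules are taken with respect to $\mathfrak h$ and have finite-dimensional weight spaces. A simple weight $\mathfrak g$-module is called $\mathfrak p(\prec)$-aligned if it is isomorphic to the unique simple quotient of $U(\mathfrak g)\otimes_{U(\mathfrak p(\prec))}S$ for some simple weight $\mathfrak l(\prec)$-module $S$, on which $\mathfrak u(\prec)$ acts by $0$. *Sequences.* Let $R(\prec)$ be the set of all $\omega\in\mathbb C^{\mathbb Z_{>0}}$ such that $\omega_k=-1$ for every $k\in\mathbb Z_{>0}$ with $[k]\prec[0]$ and $\omega_k=0$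 for every $k\in\mathbb Z_{>0}$ with $[k]\succ[0]$. Let $R_\mu(\prec)=\{\omega\in R(\prec)\mid\omega\sim_{\mathfrak{sp}}\mu\}$. Let $\omega(+)$ (resp. $\omega(-)$) be the element of $R(\prec)$ all of whose entries at indices in $[0]\cap\mathbb Z_{>0}$ are $0$ (resp. $-1$). **Proposition.** Let $\mu\in\mathbb C^{\mathbb Z_{>0}}$ and let $\prec$ be an admissible $\mathbb Z_2$-linear partial order on $\mathbb Z$. Then $X_{\mathfrak{sp}}(\mu)$ is $\mathfrak p(\prec)$-aligned if and only if one of the following statements holds (where $i_0$ always denotes a positive integer): 1. $\{[i]\prec[0]\}$ has no maximal element, $\{[i]\succ[0]\}$ has no minimal element, and $\mu\sim_{\mathfrak{sp}}\omega$ for some $\omega\in R_\mu(\prec)$. 2. $\{[i]\prec[0]\}$ has a maximal element $[i']$, $\{[i]\succ[0]\}$ has no minimal element, and either $\mu\sim_{\mathfrak{sp}}\omega(+)-\varepsilon_{i_0}$ for some $i_0\in[i']$, or $\mu\sim_{\mathfrak{sp}}\omega$ for some $\omega\in R_\mu(\prec)$. 3. $\{[i]\succ[0]\}$ has a minimal element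 $[i']$, $\{[i]\prec[0]\}$ has no maximal element, and either $\mu\sim_{\mathfrak{sp}}\omega(-)+\varepsilon_{i_0}$ for some $i_0\in[i']$, or $\mu\sim_{\mathfrak{sp}}\omega$ for some $\omega\in R_\mu(\prec)$. 4. $\{[i]\prec[0]\}$ has a maximal element $[i_1]$, $\{[i]\succ[0]\}$ has a minimal element $[i_2]$, and either $\mu\sim_{\mathfrak{sp}}\omega(+)-\varepsilon_{i_0}$ for some $i_0\in[i_1]$, or $\mu\sim_{\mathfrak{sp}}\omega(-)+\varepsilon_{i_0}$ for some $i_0\in[i_2]$, or $\mu\sim_{\mathfrak{sp}}\omega$ for some $\omega\in R_\mu(\prec)$. -/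

import Mathlib

noncomputable section

namespace SpInfty

attribute [local instance 100] LieRing.ofAssociativeRing

/-! ### The Lie algebra `sp(∞)` -/

/-- Index set of the standard basis of the natural module: `Sum.inl i` indexes the vector `e_i`
of weight `ε_i`, and `Sum.inr i` indexes the vector `f_i` of weight `-ε_i`. -/
abbrev Idx : Type := ℕ+ ⊕ ℕ+

/-- The natural module `V`, of countable dimension. -/
abbrev NatRep : Type := Idx →₀ ℂ

/-- The standard basis vectors of the natural module. -/
def e (a : Idx) : NatRep := Finsupp.single a 1

/-- The symplectic form, `Ω(e_i, f_j) = δ_ij = -Ω(f_j, e_i)`, `Ω(e_i, e_j) = Ω(f_i, f_j) = 0`. -/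
def form : NatRep →ₗ[ℂ] NatRep →ₗ[ℂ] ℂ :=
  Finsupp.linearCombination ℂ
    (Sum.elim (fun i : ℕ+ => Finsupp.lapply (Sum.inr i) (R := ℂ) (M := ℂ))
      (fun i : ℕ+ => -Finsupp.lapply (Sum.inl i) (R := ℂ) (M := ℂ)))

/-- `sp(∞)`, the union of the `sp(2n)`: endomorphisms of the natural module which are
infinitesimal isometries of the symplectic form and kill all but finitely many of the standard
basis vectors (equivalently, have finitely many nonzero matrix entries). -/
def sp : LieSubalgebra ℂ (Module.End ℂ NatRep) where
  carrier := {X | (∀ u v, form (X u) v + form u (X v) = 0) ∧ {a : Idx | X (e a) ≠ 0}.Finite}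
  add_mem' := by
    rintro X Y ⟨hX, hX'⟩ ⟨hY, hY'⟩
    refine ⟨fun u v => ?_, (hX'.union hY').subset fun a ha => ?_⟩
    · simp only [LinearMap.add_apply, map_add]
      linear_combination hX u v + hY u v
    · by_contra h
      simp only [Set.mem_union, Set.mem_ofPred_eq, not_or, not_not] at h
      exact ha (by simp [h.1, h.2])
  zero_mem' := by simp
  smul_mem' := by
    rintro c X ⟨hX, hX'⟩
    refine ⟨fun u v => ?_, hX'.subset fun a ha => ?_⟩
    · simp only [LinearMap.smul_apply, map_smul, smul_eq_mul]
      linear_combination c * hX u v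
    · intro h
      exact ha (by simp [h])
  lie_mem' := by
    rintro X Y ⟨hX, hX'⟩ ⟨hY, hY'⟩
    refine ⟨fun u v => ?_, (hX'.union hY').subset fun a ha => ?_⟩
    · simp only [Ring.lie_def, LinearMap.sub_apply, Module.End.mul_apply, map_sub]
      linear_combination hX (Y u) v - hY u (X v) - hY (X u) v + hX u (Y v)
    · by_contra h
      simp only [Set.mem_union, Set.mem_ofPred_eq, not_or, not_not] at h
      exact ha (by simp [Ring.lie_def, h.1, h.2])

/-! ### Polynomial differential operators on formal monomials -/

/-- The sequence `ε_i` that has `1` at the `i`-th entry and zeros elsewhere. -/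
def ε (i : ℕ+) : ℕ+ → ℂ := Pi.single i 1

/-- The space with basis all formal monomials `x^λ = ∏ x_i ^ λ_i`, `λ ∈ ℂ^{ℤ_{>0}}`. -/
abbrev Fock : Type := (ℕ+ → ℂ) →₀ ℂ

/-- The formal monomial `x^λ`. -/
def mono (lam : ℕ+ → ℂ) : Fock := Finsupp.single lam 1

/-- Multiplication by `x_i`, i.e. `x^λ ↦ x^{λ + ε_i}`. -/
def mulX (i : ℕ+) : Module.End ℂ Fock :=
  Finsupp.linearCombination ℂ fun lam => mono (lam + ε i)

/-- The derivation `∂_i`, i.e. `x^λ ↦ λ_i x^{λ - ε_i}`. -/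
def dX (i : ℕ+) : Module.End ℂ Fock :=
  Finsupp.linearCombination ℂ fun lam => lam i • mono (lam - ε i)

/-- The linear map sending `e_i` to `x_i` and `f_i` to `-∂_i`. -/
def psi : NatRep →ₗ[ℂ] Module.End ℂ Fock :=
  Finsupp.linearCombination ℂ (Sum.elim mulX fun i => -dX i)

/-- `∂_i` for the index of `e_i`, and `x_i` for the index of `f_i`. -/
def coOp : Idx → Module.End ℂ Fock := Sum.elim dX mulX

/-- The operator by which `X ∈ sp(∞)` acts,
`(1/2) ∑_i (psi (X e_i) ∂_i + psi (X f_i) x_i)` (only finitely many summands are nonzero).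
If `X` has the blocks `A, B, C, -Aᵀ`, i.e. `X e_j = ∑ A_ij e_i + ∑ C_ij f_i` and
`X f_j = ∑ B_ij e_i - ∑ A_ji f_i`, this is
`∑ A_ij (x_i ∂_j + δ_ij / 2) + (1/2) ∑ B_ij x_i x_j - (1/2) ∑ C_ij ∂_i ∂_j`.
So suitable root vectors of weight `ε_i - ε_j`, `ε_i + ε_j`, `2ε_i`, `-ε_i - ε_j`, `-2ε_i`
(`i ≠ j`) act by `x_i ∂_j`, `x_i x_j`, `(1/2) x_i²`, `-∂_i ∂_j`, `-(1/2) ∂_i²`. -/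
def op (X : sp) : Module.End ℂ Fock :=
  (1 / 2 : ℂ) • ∑ᶠ a : Idx, psi (X.1 (e a)) * coOp a

theorem mulX_mono (i : ℕ+) (lam : ℕ+ → ℂ) : mulX i (mono lam) = mono (lam + ε i) := by
  simp [mulX, mono]

theorem dX_mono (i : ℕ+) (lam : ℕ+ → ℂ) : dX i (mono lam) = lam i • mono (lam - ε i) := by
  simp [dX, mono]

theorem op_eq_sum (X : sp) (s : Finset Idx) (hs : ∀ a, X.1 (e a) ≠ 0 → a ∈ s) :
    op X = (1 / 2 : ℂ) • ∑ a ∈ s, psi (X.1 (e a)) * coOp a := by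
  rw [op, finsum_eq_sum_of_support_subset]
  intro a ha
  refine hs a fun h => ha ?_
  simp [h]

theorem exists_finset (X : sp) : ∃ s : Finset Idx, ∀ a, X.1 (e a) ≠ 0 → a ∈ s :=
  ⟨X.2.2.toFinset, fun a ha => by simpa using ha⟩

theorem Fock_ext {S T : Module.End ℂ Fock} (h : ∀ lam, S (mono lam) = T (mono lam)) : S = T :=
  Finsupp.lhom_ext' fun lam => LinearMap.ext_ring (h lam)

theorem mulX_comm (i j : ℕ+) : mulX i * mulX j = mulX j * mulX i :=
  Fock_ext fun lam => by
    simp only [Module.End.mul_apply, mulX_mono]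
    congr 1; abel

theorem dX_comm (i j : ℕ+) : dX i * dX j = dX j * dX i :=
  Fock_ext fun lam => by
    rcases eq_or_ne i j with rfl | h
    · rfl
    · simp only [Module.End.mul_apply, dX_mono, map_smul, smul_smul, Pi.sub_apply, ε,
        Pi.single_eq_of_ne h, Pi.single_eq_of_ne h.symm, sub_zero]
      rw [mul_comm, sub_right_comm]

theorem dX_mulX (i j : ℕ+) :
    dX i * mulX j = mulX j * dX i + (if i = j then (1 : Module.End ℂ Fock) else 0) :=
  Fock_ext fun lam => by
    rcases eq_or_ne i j with rfl | h
    · simp [Module.End.mul_apply, dX_mono, mulX_mono, ε, add_smul]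
    · simp only [Module.End.mul_apply, dX_mono, mulX_mono, map_smul, ε,
        Pi.add_apply, Pi.single_eq_of_ne h, add_zero, if_neg h]
      congr 2; abel

/-- The basis dual to `e_i, f_i` with respect to the symplectic form. -/
def dual : Idx → NatRep := Sum.elim (fun i => -e (Sum.inr i)) (fun i => e (Sum.inl i))

theorem psi_e (a : Idx) : psi (e a) = Sum.elim mulX (fun i => -dX i) a := by
  simp [psi, e]

theorem psi_dual (a : Idx) : psi (dual a) = coOp a := by
  rcases a with i | i
  · have h : psi (dual (Sum.inl i)) = -psi (e (Sum.inr i)) := by simp only [dual, Sum.elim_inl, map_neg]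
    rw [h, psi_e]
    exact neg_neg (dX i)
  · simp [dual, psi_e, coOp]

theorem form_dual (a : Idx) (v : NatRep) : form (dual a) v = v a := by
  rcases a with i | i <;> simp [dual, form, e]

theorem ring_aux₁ {R : Type*} [Ring R] {a b : R} (h : a * b = b * a) : a * -b = -b * a := by
  rw [mul_neg, neg_mul, h]

theorem ring_aux₂ {R : Type*} [Ring R] {d x c : R} (h : d * x = x * d + c) :
    x * -d = -d * x + c := by
  rw [mul_neg, neg_mul, h]
  abel

theorem coOp_psi (a : Idx) (v : NatRep) :
    coOp a * psi v = psi v * coOp a + v a • (1 : Module.End ℂ Fock) := by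
  induction v using Finsupp.induction_linear with
  | zero => simp
  | add f g hf hg => simp only [map_add, mul_add, add_mul, hf, hg, Finsupp.add_apply, add_smul]; abel
  | single b c =>
    have hb : Finsupp.single b c = c • e b := by simp [e]
    rw [hb]
    simp only [map_smul, psi_e, mul_smul_comm, smul_mul_assoc, Finsupp.smul_apply, smul_assoc]
    rw [← smul_add]
    congr 1
    rcases a with i | i <;> rcases b with j | j
    · by_cases h : i = j <;> simp [coOp, dX_mulX, e, h]
    · have h := ring_aux₁ (R := Module.End ℂ Fock) (dX_comm i j)
      simpa [coOp, e] using h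
    · simp [coOp, mulX_comm i j, e]
    · have h := ring_aux₂ (R := Module.End ℂ Fock) (dX_mulX j i)
      by_cases hij : i = j
      · simpa [coOp, e, hij] using h
      · simpa [coOp, e, hij, Ne.symm hij] using h

theorem psi_comm (u v : NatRep) :
    psi u * psi v = psi v * psi u + form u v • (1 : Module.End ℂ Fock) := by
  induction u using Finsupp.induction_linear with
  | zero => simp
  | add f g hf hg =>
    simp only [map_add, mul_add, add_mul, hf, hg, LinearMap.add_apply, add_smul]; abel
  | single b c =>
    have hb : ∃ c' : ℂ, ∃ a : Idx, Finsupp.single b c = c' • dual a := by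
      rcases b with i | i
      · exact ⟨c, Sum.inr i, by simp [dual, e]⟩
      · exact ⟨-c, Sum.inl i, by simp [dual, e]⟩
    obtain ⟨c', a, h⟩ := hb
    rw [h]
    simp only [map_smul, LinearMap.smul_apply, form_dual, psi_dual, smul_mul_assoc, coOp_psi,
      mul_smul_comm, smul_add, smul_assoc]

theorem exists_expand (w : NatRep) : ∃ t₀ : Finset Idx, ∀ t : Finset Idx, t₀ ⊆ t →
    ∑ a ∈ t, form w (e a) • dual a = w := by
  induction w using Finsupp.induction_linear with
  | zero => exact ⟨∅, by simp⟩
  | add f g hf hg =>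
    obtain ⟨s, hs⟩ := hf
    obtain ⟨t, ht⟩ := hg
    classical
    refine ⟨s ∪ t, fun r hr => ?_⟩
    simp only [map_add, LinearMap.add_apply, add_smul, Finset.sum_add_distrib,
      hs r (Finset.union_subset_left hr), ht r (Finset.union_subset_right hr)]
  | single b c =>
    refine ⟨{b.swap}, fun t ht => ?_⟩
    rw [Finset.sum_eq_single_of_mem b.swap (ht (by simp))]
    · rcases b with i | i <;> simp [form, e, dual]
    · rintro a - ha
      rcases b with i | i <;> rcases a with j | j <;> simp_all [form, e]

theorem op_psi (X : sp) (v : NatRep) : op X * psi v = psi v * op X + psi (X.1 v) := by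
  induction v using Finsupp.induction_linear with
  | zero => simp
  | add f g hf hg => simp only [map_add, mul_add, add_mul, hf, hg]; abel
  | single b c =>
    have hb : Finsupp.single b c = c • e b := by simp [e]
    rw [hb]
    simp only [map_smul, mul_smul_comm, smul_mul_assoc]
    rw [← smul_add]
    congr 1
    classical
    obtain ⟨s₀, hs₀⟩ := exists_finset X
    obtain ⟨t₀, ht₀⟩ := exists_expand (X.1 (e b))
    set s := insert b (s₀ ∪ t₀) with hs
    have h1 : ∀ a ∈ s, psi (X.1 (e a)) * coOp a * psi (e b)
        = psi (e b) * (psi (X.1 (e a)) * coOp a) + (e b a) • psi (X.1 (e a))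
          + psi (form (X.1 (e b)) (e a) • dual a) := by
      intro a _
      have h2 : form (X.1 (e a)) (e b) = form (X.1 (e b)) (e a) := by
        have h3 := X.2.1 (e a) (e b)
        have h4 : ∀ u v : NatRep, form u v = - form v u := by
          intro u v
          induction u using Finsupp.induction_linear with
          | zero => simp
          | add f g hf hg => simp only [map_add, LinearMap.add_apply, hf, hg]; ring
          | single i x =>
            induction v using Finsupp.induction_linear with
            | zero => simp
            | add f g hf hg => simp only [map_add, LinearMap.add_apply, hf, hg]; ring
            | single j y =>
              rcases i with i | i <;> rcases j with j | j <;> rcases eq_or_ne i j with hij | hij <;>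
                simp [form, hij, mul_comm, eq_comm]
        rw [h4 (X.1 (e b)) (e a)]
        linear_combination h3
      rw [mul_assoc, coOp_psi, mul_add, ← mul_assoc, psi_comm (X.1 (e a)) (e b), h2]
      simp only [add_mul, mul_smul_comm, smul_mul_assoc, mul_one, one_mul, map_smul, psi_dual,
        mul_assoc]
      abel
    rw [op_eq_sum X s fun a ha => by
      rw [hs]; exact Finset.mem_insert_of_mem (Finset.mem_union_left _ (hs₀ a ha))]
    rw [smul_mul_assoc, Finset.sum_mul, Finset.sum_congr rfl h1, Finset.sum_add_distrib,
      Finset.sum_add_distrib, ← map_sum psi, ht₀ s (by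
        rw [hs]; exact Finset.subset_union_right.trans (Finset.subset_insert _ _)),
      ← Finset.mul_sum, mul_smul_comm]
    have h5 : e b b = 1 := by simp [e]
    have h6 : ∑ a ∈ s, e b a • psi (X.1 (e a)) = psi (X.1 (e b)) := by
      rw [Finset.sum_eq_single_of_mem b (by simp [hs]), h5, one_smul]
      intro a _ ha
      have h7 : e b a = 0 := by simp [e, Finsupp.single_eq_of_ne ha]
      rw [h7, zero_smul]
    rw [h6, add_assoc, smul_add, ← two_smul ℂ (psi (X.1 (e b))), smul_smul]
    norm_num

theorem sum_expand (w : NatRep) (s : Finset Idx) (hs : w.support ⊆ s) :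
    ∑ b ∈ s, w b • e b = w := by
  conv_rhs => rw [← Finsupp.sum_single w]
  rw [Finsupp.sum_of_support_subset w hs _ (by simp)]
  exact Finset.sum_congr rfl fun b _ => by simp [e]

theorem op_lie (X Y : sp) : op X * op Y = op Y * op X + op ⁅X, Y⁆ := by
  classical
  obtain ⟨sX, hX⟩ := exists_finset X
  obtain ⟨sY, hY⟩ := exists_finset Y
  choose t ht using fun b => exists_expand (X.1 (dual b))
  set s := (sX ∪ sY) ∪ (sY.biUnion t ∪ sX.biUnion fun a => (X.1 (e a)).support) with hs
  have hXs : ∀ a, X.1 (e a) ≠ 0 → a ∈ s := fun a ha => by simp [hs, hX a ha]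
  have hYs : ∀ a, Y.1 (e a) ≠ 0 → a ∈ s := fun a ha => by simp [hs, hY a ha]
  have hXYs : ∀ a, (⁅X, Y⁆ : sp).1 (e a) ≠ 0 → a ∈ s := fun a ha => by
    by_contra h
    have h1 : X.1 (e a) = 0 := by by_contra h'; exact h (hXs a h')
    have h2 : Y.1 (e a) = 0 := by by_contra h'; exact h (hYs a h')
    exact ha (by simp [Ring.lie_def, h1, h2])
  have key : ∑ b ∈ s, psi (Y.1 (e b)) * psi (X.1 (dual b))
      = (-1 : ℂ) • ∑ a ∈ s, psi (Y.1 (X.1 (e a))) * psi (dual a) := by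
    have h1 : ∀ b ∈ s, psi (Y.1 (e b)) * psi (X.1 (dual b))
        = ∑ a ∈ s, (-1 : ℂ) • ((X.1 (e a) b) • (psi (Y.1 (e b)) * psi (dual a))) := by
      intro b _
      by_cases hb : Y.1 (e b) = 0
      · rw [hb, map_zero, zero_mul]
        exact (Finset.sum_eq_zero fun a _ => by rw [zero_mul, smul_zero, smul_zero]).symm
      · have hts : t b ⊆ s := fun a ha => by
          simp only [hs, Finset.mem_union, Finset.mem_biUnion]
          exact Or.inr (Or.inl ⟨b, hY b hb, ha⟩)
        conv_lhs => rw [← ht b s hts]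
        rw [map_sum, Finset.mul_sum]
        refine Finset.sum_congr rfl fun a _ => ?_
        have h3 : form (X.1 (dual b)) (e a) = -(X.1 (e a) b) := by
          have := X.2.1 (dual b) (e a)
          rw [form_dual] at this
          linear_combination this
        rw [h3, map_smul, mul_smul_comm, smul_smul, neg_one_mul]
    rw [Finset.sum_congr rfl h1, Finset.sum_comm, Finset.smul_sum]
    refine Finset.sum_congr rfl fun a _ => ?_
    rw [← Finset.smul_sum]
    congr 1
    have h4 : ∑ b ∈ s, (X.1 (e a) b) • e b = X.1 (e a) := by
      refine sum_expand _ _ ?_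
      by_cases ha : X.1 (e a) = 0
      · simp [ha]
      · intro b hb
        simp only [hs, Finset.mem_union, Finset.mem_biUnion]
        exact Or.inr (Or.inr ⟨a, hX a ha, hb⟩)
    conv_rhs => rw [← h4]
    simp only [map_sum, map_smul, Finset.sum_mul, smul_mul_assoc]
  have hmul : op X * op Y = op Y * op X
      + ((1 / 2 : ℂ) • ∑ b ∈ s, psi (X.1 (Y.1 (e b))) * psi (dual b)
        + (1 / 2 : ℂ) • ∑ b ∈ s, psi (Y.1 (e b)) * psi (X.1 (dual b))) := by
    rw [op_eq_sum Y s hYs, mul_smul_comm, smul_mul_assoc, ← smul_add, ← smul_add, Finset.mul_sum,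
      Finset.sum_mul, ← Finset.sum_add_distrib, ← Finset.sum_add_distrib]
    congr 1
    refine Finset.sum_congr rfl fun b _ => ?_
    rw [← psi_dual, ← mul_assoc, op_psi, add_mul, mul_assoc, op_psi, mul_add, mul_assoc]
    abel
  rw [hmul, key, op_eq_sum _ s hXYs, ← smul_add, Finset.smul_sum, ← Finset.sum_add_distrib]
  congr 2
  refine Finset.sum_congr rfl fun b _ => ?_
  rw [← psi_dual, ← smul_mul_assoc, ← add_mul, ← map_smul, ← map_add, neg_one_smul,
    ← sub_eq_add_neg]
  rfl

theorem op_add (X Y : sp) : op (X + Y) = op X + op Y := by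
  classical
  obtain ⟨sX, hX⟩ := exists_finset X
  obtain ⟨sY, hY⟩ := exists_finset Y
  obtain ⟨sZ, hZ⟩ := exists_finset (X + Y)
  rw [op_eq_sum X (sX ∪ sY ∪ sZ) fun a ha => by simp [hX a ha],
    op_eq_sum Y (sX ∪ sY ∪ sZ) fun a ha => by simp [hY a ha],
    op_eq_sum (X + Y) (sX ∪ sY ∪ sZ) fun a ha => by simp [hZ a ha],
    ← smul_add, ← Finset.sum_add_distrib]
  congr 1
  refine Finset.sum_congr rfl fun b _ => ?_
  rw [← add_mul, ← map_add]
  rfl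

theorem op_smul (c : ℂ) (X : sp) : op (c • X) = c • op X := by
  classical
  obtain ⟨sX, hX⟩ := exists_finset X
  obtain ⟨sZ, hZ⟩ := exists_finset (c • X)
  rw [op_eq_sum X (sX ∪ sZ) fun a ha => by simp [hX a ha],
    op_eq_sum (c • X) (sX ∪ sZ) fun a ha => by simp [hZ a ha],
    smul_comm c, Finset.smul_sum (r := c)]
  congr 1
  refine Finset.sum_congr rfl fun b _ => ?_
  rw [← smul_mul_assoc, ← map_smul]
  rfl

/-- The action of `sp(∞)` on formal monomials. -/
instance : LieRingModule sp Fock where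
  bracket X f := op X f
  add_lie X Y f := by
    change op (X + Y) f = op X f + op Y f
    rw [op_add]; rfl
  lie_add X f g := map_add (op X) f g
  leibniz_lie X Y f := by
    change op X (op Y f) = op ⁅X, Y⁆ f + op Y (op X f)
    rw [add_comm, ← LinearMap.comp_apply, ← LinearMap.comp_apply, ← LinearMap.add_apply]
    exact congrArg (fun T : Module.End ℂ Fock => T f) (op_lie X Y)

instance : LieModule ℂ sp Fock where
  smul_lie c X f := by
    change op (c • X) f = c • op X f
    rw [op_smul]; rfl
  lie_smul c X f := map_smul (op X) c f

/-! ### Roots and the modules `X_sp(μ)` -/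

/-- The roots of `sp(∞)`, as sequences: `±2ε_i` and `±ε_i ± ε_j` with `i ≠ j`. -/
def roots : Set (ℕ+ → ℂ) :=
  {α | (∃ i, α = (2 : ℂ) • ε i ∨ α = -((2 : ℂ) • ε i)) ∨
    ∃ i j, i ≠ j ∧ (α = ε i - ε j ∨ α = ε i + ε j ∨ α = -ε i - ε j)}

/-- The root lattice `Q`. -/
def rootLattice : AddSubgroup (ℕ+ → ℂ) := AddSubgroup.closure roots

/-- `Int⁺(μ)`, the set of indices `i` with `μ_i ∈ ℤ_{≥ 0}`. -/
def intPos (μ : ℕ+ → ℂ) : Set ℕ+ := {i | ∃ n : ℕ, μ i = n}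

/-- The relation `λ ∼_sp μ`. -/
def SpEquiv (lam μ : ℕ+ → ℂ) : Prop := lam - μ ∈ rootLattice ∧ intPos μ = intPos lam

theorem sub_mem_rootLattice (i j : ℕ+) : ε i - ε j ∈ rootLattice := by
  rcases eq_or_ne i j with rfl | h
  · simp
  · exact AddSubgroup.subset_closure (Or.inr ⟨i, j, h, Or.inl rfl⟩)

theorem add_mem_rootLattice (i j : ℕ+) : ε i + ε j ∈ rootLattice := by
  rcases eq_or_ne i j with rfl | h
  · exact AddSubgroup.subset_closure (Or.inl ⟨i, Or.inl (two_smul ℂ (ε i)).symm⟩)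
  · exact AddSubgroup.subset_closure (Or.inr ⟨i, j, h, Or.inr (Or.inl rfl)⟩)

/-- Exponents `λ` with `λ - μ - c ∈ Q` and `Int⁺(μ) ⊆ Int⁺(λ)`. -/
def exps (μ c : ℕ+ → ℂ) : Set (ℕ+ → ℂ) := {lam | lam - μ - c ∈ rootLattice ∧ intPos μ ⊆ intPos lam}

theorem map_supported {T : Module.End ℂ Fock} {A B : Set (ℕ+ → ℂ)}
    (h : ∀ lam ∈ A, T (mono lam) ∈ Finsupp.supported ℂ ℂ B) {f : Fock}
    (hf : f ∈ Finsupp.supported ℂ ℂ A) : T f ∈ Finsupp.supported ℂ ℂ B := by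
  rw [Finsupp.supported_eq_span_single] at hf
  induction hf using Submodule.span_induction with
  | mem x hx =>
    obtain ⟨lam, hlam, rfl⟩ := hx
    exact h lam hlam
  | zero => simp
  | add x y _ _ hx hy => rw [map_add]; exact add_mem hx hy
  | smul c x _ hx => rw [map_smul]; exact Submodule.smul_mem _ _ hx

theorem mulX_supported {μ c c' : ℕ+ → ℂ} (i : ℕ+) (h : ε i + c - c' ∈ rootLattice) {f : Fock}
    (hf : f ∈ Finsupp.supported ℂ ℂ (exps μ c)) :
    mulX i f ∈ Finsupp.supported ℂ ℂ (exps μ c') := by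
  refine map_supported (fun lam hlam => ?_) hf
  rw [mulX_mono]
  refine Finsupp.single_mem_supported ℂ 1 ⟨?_, fun k hk => ?_⟩
  · have := add_mem hlam.1 h
    convert this using 1
    abel
  · obtain ⟨n, hn⟩ := hlam.2 hk
    rcases eq_or_ne k i with rfl | hki
    · exact ⟨n + 1, by simp [ε, hn]⟩
    · exact ⟨n, by simp [ε, hn, hki]⟩

theorem dX_supported {μ c c' : ℕ+ → ℂ} (i : ℕ+) (h : -ε i + c - c' ∈ rootLattice) {f : Fock}
    (hf : f ∈ Finsupp.supported ℂ ℂ (exps μ c)) :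
    dX i f ∈ Finsupp.supported ℂ ℂ (exps μ c') := by
  refine map_supported (fun lam hlam => ?_) hf
  rw [dX_mono]
  by_cases h0 : lam i = 0
  · rw [h0, zero_smul]; exact zero_mem _
  refine Submodule.smul_mem _ _ (Finsupp.single_mem_supported ℂ 1 ⟨?_, fun k hk => ?_⟩)
  · have := add_mem hlam.1 h
    convert this using 1
    abel
  · obtain ⟨n, hn⟩ := hlam.2 hk
    rcases eq_or_ne k i with rfl | hki
    · rcases n with _ | n
      · exact absurd (by simpa using hn) h0
      · exact ⟨n, by simp [ε, hn]⟩
    · exact ⟨n, by simp [ε, hn, hki]⟩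

theorem psi_supported {μ c c' : ℕ+ → ℂ} (h : ∀ i, ε i + c - c' ∈ rootLattice)
    (h' : ∀ i, -ε i + c - c' ∈ rootLattice) (v : NatRep) {f : Fock}
    (hf : f ∈ Finsupp.supported ℂ ℂ (exps μ c)) :
    psi v f ∈ Finsupp.supported ℂ ℂ (exps μ c') := by
  induction v using Finsupp.induction_linear with
  | zero => simp
  | add u w hu hw => rw [map_add]; exact add_mem hu hw
  | single b z =>
    have hb : Finsupp.single b z = z • e b := by simp [e]
    rw [hb, map_smul, psi_e]
    refine Submodule.smul_mem _ _ ?_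
    rcases b with i | i
    · exact mulX_supported i (h i) hf
    · exact neg_mem (dX_supported i (h' i) hf)

/-- `V_sp(μ)`, the span of the `x^λ` with `λ - μ ∈ Q` and `Int⁺(μ) ⊆ Int⁺(λ)`. -/
def V (μ : ℕ+ → ℂ) : LieSubmodule ℂ sp Fock where
  toSubmodule := Finsupp.supported ℂ ℂ {lam | lam - μ ∈ rootLattice ∧ intPos μ ⊆ intPos lam}
  lie_mem := by
    intro X f hf
    have hA : {lam | lam - μ ∈ rootLattice ∧ intPos μ ⊆ intPos lam} = exps μ 0 := by simp [exps]
    change f ∈ Finsupp.supported ℂ ℂ _ at hf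
    change op X f ∈ Finsupp.supported ℂ ℂ _
    rw [hA] at hf ⊢
    obtain ⟨s, hs⟩ := exists_finset X
    rw [op_eq_sum X s hs, LinearMap.smul_apply, LinearMap.sum_apply]
    refine Submodule.smul_mem _ _ (Submodule.sum_mem _ fun a _ => ?_)
    have h1 : ∀ i : ℕ+, ε i + ε 1 - 0 ∈ rootLattice := fun i => by
      simpa using add_mem_rootLattice i 1
    have h2 : ∀ i : ℕ+, -ε i + ε 1 - 0 ∈ rootLattice := fun i => by
      have := sub_mem_rootLattice 1 i
      rwa [sub_zero, neg_add_eq_sub]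
    have h3 : ∀ i : ℕ+, ε i + 0 - ε 1 ∈ rootLattice := fun i => by
      simpa using sub_mem_rootLattice i 1
    have h4 : ∀ i : ℕ+, -ε i + 0 - ε 1 ∈ rootLattice := fun i => by
      have := neg_mem (add_mem_rootLattice i 1)
      rwa [add_zero, ← neg_add']
    rw [Module.End.mul_apply, ← psi_dual]
    exact psi_supported h1 h2 _ (psi_supported h3 h4 _ hf)

/-- `V_sp(μ)⁺`, the sum of all `V_sp(μ')` properly contained in `V_sp(μ)`. -/
def Vplus (μ : ℕ+ → ℂ) : LieSubmodule ℂ sp (V μ) :=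
  ⨆ (μ' : ℕ+ → ℂ) (_ : V μ' < V μ), (V μ').comap (V μ).incl

/-- The `sp(∞)`-module `X_sp(μ) = V_sp(μ) / V_sp(μ)⁺`. -/
abbrev Xsp (μ : ℕ+ → ℂ) : Type := V μ ⧸ Vplus μ

/-! ### Weight spaces, root spaces and the Cartan subalgebra -/

/-- The element of the Cartan subalgebra with `ε_j(h_i) = δ_ij`: `h_i e_i = e_i`,
`h_i f_i = -f_i`, and `h_i` kills the other standard basis vectors. -/
def h (i : ℕ+) : sp :=
  ⟨(Finsupp.lsingle (Sum.inl i)).comp (Finsupp.lapply (R := ℂ) (M := ℂ) (Sum.inl i : Idx)) -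
    (Finsupp.lsingle (Sum.inr i)).comp (Finsupp.lapply (R := ℂ) (M := ℂ) (Sum.inr i : Idx)), by
    refine ⟨fun u v => ?_, (Set.toFinite {Sum.inl i, Sum.inr i}).subset fun a ha => ?_⟩
    · have hv : ∀ w : NatRep, form (e (Sum.inl i)) w = w (Sum.inr i) ∧
          form (e (Sum.inr i)) w = -w (Sum.inl i) := fun w => by simp [form, e]
      have hu : ∀ w : NatRep, form w (e (Sum.inl i)) = -w (Sum.inr i) ∧
          form w (e (Sum.inr i)) = w (Sum.inl i) := fun w => by
        induction w using Finsupp.induction_linear with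
        | zero => simp
        | add f g hf hg =>
          simp only [map_add, LinearMap.add_apply, hf.1, hf.2, hg.1, hg.2, Finsupp.add_apply]
          exact ⟨(neg_add _ _).symm, trivial⟩
        | single b c =>
          rcases b with j | j <;> by_cases hj : i = j <;>
            simp [form, e, hj, eq_comm]
      have hs : ∀ (a : Idx) (c : ℂ), (Finsupp.single a c : NatRep) = c • e a := fun a c => by
        simp [e]
      simp only [LinearMap.sub_apply, LinearMap.comp_apply, Finsupp.lsingle_apply,
        Finsupp.lapply_apply, hs, map_sub, map_smul, LinearMap.smul_apply, hv, hu, smul_eq_mul]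
      ring
    · by_contra hn
      simp only [Set.mem_insert_iff, Set.mem_singleton_iff, not_or] at hn
      exact ha (by simp [e, hn.1, hn.2])⟩

/-- The weight space of weight `ν` of a module `M` over a Lie algebra `L`, with respect to a
family `t` of elements of `L` (which will be the `h_i`); the functional with value `ν_i` on `h_i`
is identified with the sequence `ν`. -/
def wtSpace {L : Type*} [LieRing L] [LieAlgebra ℂ L] (t : ℕ+ → L) (M : Type*) [AddCommGroup M]
    [Module ℂ M] [LieRingModule L M] [LieModule ℂ L M] (ν : ℕ+ → ℂ) : Submodule ℂ M :=
  ⨅ i, (LieModule.toEnd ℂ L M (t i)).eigenspace (ν i)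

/-- Weight modules with finite-dimensional weight spaces. (Distinct weight spaces are always
linearly independent, so the sum is direct.) -/
def IsWeightModule {L : Type*} [LieRing L] [LieAlgebra ℂ L] (t : ℕ+ → L) (M : Type*)
    [AddCommGroup M] [Module ℂ M] [LieRingModule L M] [LieModule ℂ L M] : Prop :=
  (⨆ ν, wtSpace t M ν) = ⊤ ∧ ∀ ν, FiniteDimensional ℂ (wtSpace t M ν)

/-- The root space `g_α`. -/
def rootSpace (α : ℕ+ → ℂ) : Submodule ℂ sp := wtSpace h sp α

/-! ### Orders and parabolic subalgebras -/

/-- Multiplication by `-1` reverses the order. -/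
def IsZ2Linear (r : ℤ → ℤ → Prop) : Prop := ∀ i j, r i j → r (-j) (-i)

/-- `[i]`: the element `i` together with all elements which are not comparable with `i`. -/
def block (r : ℤ → ℤ → Prop) (i : ℤ) : Set ℤ := {j | j = i ∨ (¬ r i j ∧ ¬ r j i)}

/-- The order is admissible: distinct sets `[i]` are disjoint. -/
def IsAdmissible (r : ℤ → ℤ → Prop) : Prop :=
  ∀ i j, block r i ≠ block r j → block r i ∩ block r j = ∅

/-- The relation `A ≺ B` between subsets. -/
def SetLT (r : ℤ → ℤ → Prop) (A B : Set ℤ) : Prop := ∀ a ∈ A, ∀ b ∈ B, r a b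

/-- `P(≺)⁺`, the set of roots `α ≻ 0`. -/
def posRoots (r : ℤ → ℤ → Prop) : Set (ℕ+ → ℂ) :=
  {α | (∃ i : ℕ+, r i 0 ∧ α = (2 : ℂ) • ε i) ∨
    (∃ i : ℕ+, r (-i) 0 ∧ α = -((2 : ℂ) • ε i)) ∨
    (∃ i j : ℕ+, r i j ∧ α = ε i - ε j) ∨
    (∃ i j : ℕ+, r i (-j) ∧ α = ε i + ε j) ∨
    ∃ i j : ℕ+, r (-i) j ∧ α = -ε i - ε j}

/-- `P(≺)⁰`, the set of roots not comparable with `0`. -/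
def zeroRoots (r : ℤ → ℤ → Prop) : Set (ℕ+ → ℂ) :=
  {α | α ∈ roots ∧ α ∉ posRoots r ∧ -α ∉ posRoots r}

/-- The subalgebra generated by the Cartan subalgebra and the root spaces `g_α`, `α ∈ P`. -/
def subalgebraOf (P : Set (ℕ+ → ℂ)) : LieSubalgebra ℂ sp :=
  LieSubalgebra.lieSpan ℂ sp (Set.range h ∪ ⋃ α ∈ P, (rootSpace α : Set sp))

/-- The parabolic subalgebra `p(≺)`. -/
def parabolic (r : ℤ → ℤ → Prop) : LieSubalgebra ℂ sp := subalgebraOf (posRoots r ∪ zeroRoots r)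

/-- The reductive component `l(≺)` of `p(≺)`. -/
def levi (r : ℤ → ℤ → Prop) : LieSubalgebra ℂ sp := subalgebraOf (zeroRoots r)

/-- The locally nilpotent radical `u(≺)` of `p(≺)`. -/
def nilradical (r : ℤ → ℤ → Prop) : LieSubalgebra ℂ sp :=
  LieSubalgebra.lieSpan ℂ sp (⋃ α ∈ posRoots r, (rootSpace α : Set sp))

/-- The element `h_i`, as an element of `p(≺)`. -/
def hIn (r : ℤ → ℤ → Prop) (i : ℕ+) : parabolic r :=
  ⟨h i, LieSubalgebra.subset_lieSpan (Or.inl ⟨i, rfl⟩)⟩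

/-! ### Generalized Verma modules and aligned modules -/

section Induced

variable {L : Type*} [LieRing L] [LieAlgebra ℂ L]

/-- The left `U(L)`-submodule of `U(L) ⊗_ℂ S` generated by the elements
`u v ⊗ s - u ⊗ v s`, for `u ∈ U(L)`, `v ∈ U(p)`, `s ∈ S`. -/
def inducedRel (p : LieSubalgebra ℂ L) (S : Type*) [AddCommGroup S] [Module ℂ S]
    [LieRingModule p S] [LieModule ℂ p S] :
    Submodule (UniversalEnvelopingAlgebra ℂ L)
      (TensorProduct ℂ (UniversalEnvelopingAlgebra ℂ L) S) :=
  Submodule.span (UniversalEnvelopingAlgebra ℂ L)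
    {z | ∃ (u : UniversalEnvelopingAlgebra ℂ L) (v : UniversalEnvelopingAlgebra ℂ p) (s : S),
      z = TensorProduct.tmul ℂ
            (u * UniversalEnvelopingAlgebra.lift ℂ
              ((UniversalEnvelopingAlgebra.ι ℂ).comp p.incl) v) s -
          TensorProduct.tmul ℂ u
            (UniversalEnvelopingAlgebra.lift ℂ (LieModule.toEnd ℂ p S) v s)}

/-- The induced module `U(L) ⊗_{U(p)} S`. -/
def Induced (p : LieSubalgebra ℂ L) (S : Type*) [AddCommGroup S] [Module ℂ S]
    [LieRingModule p S] [LieModule ℂ p S] : Type _ :=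
  TensorProduct ℂ (UniversalEnvelopingAlgebra ℂ L) S ⧸ inducedRel p S

variable (p : LieSubalgebra ℂ L) (S : Type*) [AddCommGroup S] [Module ℂ S]
  [LieRingModule p S] [LieModule ℂ p S]

instance : AddCommGroup (Induced p S) :=
  inferInstanceAs (AddCommGroup (_ ⧸ inducedRel p S))

instance : Module (UniversalEnvelopingAlgebra ℂ L) (Induced p S) :=
  inferInstanceAs (Module (UniversalEnvelopingAlgebra ℂ L) (_ ⧸ inducedRel p S))

instance : Module ℂ (Induced p S) :=
  inferInstanceAs (Module ℂ (_ ⧸ inducedRel p S))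

instance : IsScalarTower ℂ (UniversalEnvelopingAlgebra ℂ L) (Induced p S) :=
  inferInstanceAs (IsScalarTower ℂ (UniversalEnvelopingAlgebra ℂ L) (_ ⧸ inducedRel p S))

/-- `L` acts on the induced module through the left `U(L)`-module structure. -/
instance : LieRingModule L (Induced p S) where
  bracket x m := UniversalEnvelopingAlgebra.ι ℂ x • m
  add_lie x y m := by
    change UniversalEnvelopingAlgebra.ι ℂ (x + y) • m = _
    rw [map_add, add_smul]
  lie_add x m n := smul_add _ m n
  leibniz_lie x y m := by
    change UniversalEnvelopingAlgebra.ι ℂ x • UniversalEnvelopingAlgebra.ι ℂ y • m =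
      UniversalEnvelopingAlgebra.ι ℂ ⁅x, y⁆ • m +
        UniversalEnvelopingAlgebra.ι ℂ y • UniversalEnvelopingAlgebra.ι ℂ x • m
    rw [LieHom.map_lie, Ring.lie_def, sub_smul, mul_smul, mul_smul, sub_add_cancel]

instance : LieModule ℂ L (Induced p S) where
  smul_lie c x m := by
    change UniversalEnvelopingAlgebra.ι ℂ (c • x) • m = c • UniversalEnvelopingAlgebra.ι ℂ x • m
    rw [map_smul, smul_assoc]
  lie_smul c x m := by
    change UniversalEnvelopingAlgebra.ι ℂ x • c • m = c • UniversalEnvelopingAlgebra.ι ℂ x • m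
    rw [← algebraMap_smul (UniversalEnvelopingAlgebra ℂ L) c m,
      ← algebraMap_smul (UniversalEnvelopingAlgebra ℂ L) c
        (UniversalEnvelopingAlgebra.ι ℂ x • m), smul_smul, smul_smul, Algebra.commutes]

end Induced

/-- `M` is `p(≺)`-aligned: it is a simple weight module, and for some simple weight `l(≺)`-module
`S`, made into a `p(≺)`-module by letting `u(≺)` act as zero, `M` is isomorphic to the simple
quotient of the generalized Verma module `U(g) ⊗_{U(p(≺))} S` (whose maximal proper submodule `N`
is unique). -/
def IsAligned (r : ℤ → ℤ → Prop) (M : Type) [AddCommGroup M] [Module ℂ M]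
    [LieRingModule sp M] [LieModule ℂ sp M] : Prop :=
  LieModule.IsIrreducible ℂ sp M ∧ IsWeightModule h M ∧
  ∃ (S : Type) (_ : AddCommGroup S) (_ : Module ℂ S) (_ : LieRingModule (parabolic r) S)
    (_ : LieModule ℂ (parabolic r) S),
    IsWeightModule (hIn r) S ∧
    (∀ x : parabolic r, x.1 ∈ nilradical r → ∀ s : S, ⁅x, s⁆ = 0) ∧
    (Nontrivial S ∧ ∀ W : Submodule ℂ S,
      (∀ x : parabolic r, x.1 ∈ levi r → ∀ s ∈ W, ⁅x, s⁆ ∈ W) → W = ⊥ ∨ W = ⊤) ∧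
    ∃ N : LieSubmodule ℂ sp (Induced (parabolic r) S), IsCoatom N ∧
      Nonempty (M ≃ₗ⁅ℂ, sp⁆ (Induced (parabolic r) S ⧸ N))

/-! ### The sets and sequences of the criterion -/

/-- The set `{[i] ≺ [0]}` of blocks. -/
def blocksBelow (r : ℤ → ℤ → Prop) : Set (Set ℤ) :=
  {B | (∃ i, B = block r i) ∧ SetLT r B (block r 0)}

/-- The set `{[i] ≻ [0]}` of blocks. -/
def blocksAbove (r : ℤ → ℤ → Prop) : Set (Set ℤ) :=
  {B | (∃ i, B = block r i) ∧ SetLT r (block r 0) B}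

/-- `B` is a maximal element of the set of blocks `𝓑`. -/
def IsMaxBlock (r : ℤ → ℤ → Prop) (𝓑 : Set (Set ℤ)) (B : Set ℤ) : Prop :=
  B ∈ 𝓑 ∧ ∀ C ∈ 𝓑, ¬ SetLT r B C

/-- `B` is a minimal element of the set of blocks `𝓑`. -/
def IsMinBlock (r : ℤ → ℤ → Prop) (𝓑 : Set (Set ℤ)) (B : Set ℤ) : Prop :=
  B ∈ 𝓑 ∧ ∀ C ∈ 𝓑, ¬ SetLT r C B

/-- `R(≺)`: sequences equal to `-1` on the blocks `[i] ≺ [0]` and to `0` on the blocks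
`[i] ≻ [0]` (at positive indices). -/
def R (r : ℤ → ℤ → Prop) : Set (ℕ+ → ℂ) :=
  {ω | (∀ B ∈ blocksBelow r, ∀ k : ℕ+, (k : ℤ) ∈ B → ω k = -1) ∧
    ∀ B ∈ blocksAbove r, ∀ k : ℕ+, (k : ℤ) ∈ B → ω k = 0}

/-- `R_μ(≺)`. -/
def Rmu (r : ℤ → ℤ → Prop) (μ : ℕ+ → ℂ) : Set (ℕ+ → ℂ) := {ω | ω ∈ R r ∧ SpEquiv ω μ}

/-- `ω` is `ω(+)`: the element of `R(≺)` that vanishes on `[0] ∩ ℤ_{>0}`. -/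
def IsOmegaPlus (r : ℤ → ℤ → Prop) (ω : ℕ+ → ℂ) : Prop :=
  ω ∈ R r ∧ ∀ k : ℕ+, (k : ℤ) ∈ block r 0 → ω k = 0

/-- `ω` is `ω(-)`: the element of `R(≺)` that is equal to `-1` on `[0] ∩ ℤ_{>0}`. -/
def IsOmegaMinus (r : ℤ → ℤ → Prop) (ω : ℕ+ → ℂ) : Prop :=
  ω ∈ R r ∧ ∀ k : ℕ+, (k : ℤ) ∈ block r 0 → ω k = -1

/-- `μ ∼ ω(+) - ε_{i₀}` for some positive `i₀ ∈ B`. -/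
def EquivOmegaPlus (r : ℤ → ℤ → Prop) (μ : ℕ+ → ℂ) (B : Set ℤ) : Prop :=
  ∃ ω, IsOmegaPlus r ω ∧ ∃ i₀ : ℕ+, (i₀ : ℤ) ∈ B ∧ SpEquiv μ (ω - ε i₀)

/-- `μ ∼ ω(-) + ε_{i₀}` for some positive `i₀ ∈ B`. -/
def EquivOmegaMinus (r : ℤ → ℤ → Prop) (μ : ℕ+ → ℂ) (B : Set ℤ) : Prop :=
  ∃ ω, IsOmegaMinus r ω ∧ ∃ i₀ : ℕ+, (i₀ : ℤ) ∈ B ∧ SpEquiv μ (ω + ε i₀)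

end SpInfty

end

noncomputable section

namespace SpInfty

attribute [local instance 100] LieRing.ofAssociativeRing

/-! ### Signed indices -/

/-! The quotient `X_sp(μ)` has as a basis the monomials whose exponents lie in the `∼_sp`-class of
`μ` (`basisX`). Their weights are distinct, so weight spaces have dimension at most one. A root
vector of weight `α` sends the monomial of exponent `λ` to a multiple of that of exponent `λ + α`;
for the vectors `rootVec` the multiple is nonzero exactly when `λ + α` stays in the class. Questions
about submodules thus become questions about moves inside the class. Any two members of a class are
joined by root moves, so `X_sp(μ)` is simple.

An aligned module contains a nonzero vector killed by `u(≺)`, namely the image of some `1 ⊗ s`. The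
killed vectors form an `h`-stable space, so some monomial is killed; its exponent is extremal.
Conversely, from an extremal exponent the moves by Levi roots reach only extremal exponents. The
monomials reached span a simple `l(≺)`-module on which `u(≺)` vanishes, and Frobenius reciprocity
gives a nonzero map from its induced module onto `X_sp(μ)`. Hence alignment is the existence of an
extremal exponent (`isAligned_Xsp_iff`).

The rest is combinatorics. With signed indices `±i` and exponent `-1 - λ_i` along `-i`, a unit move
along `a` changes `Int⁺` exactly when the exponent along `a` is `-1`; the roots are `wt a + wt b`
with `b ≠ -a`, and such a root is positive when `a ≺ -b`. Extremal exponents are then of two kinds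
(`isStd_or_isExceptional`): elements of `R(≺)`, with exponent `-1` along every `a ≺ 0`; and, only if
`[0] = {0}`, an element of `R(≺)` minus `wt k`, with `k` in the last block below `0`. If `[0]` is
larger, the sequences `ω(±) ∓ ε_{i₀}` of the criterion are equivalent to elements of `R(≺)`, so
listing them is harmless. Negation exchanges the blocks below and above `[0]`, so a maximal block
below exists exactly when a minimal one above does; cases 2 and 3 never occur. -/

/-- The weight `±ε_i` of a standard basis vector of the natural module. -/
def wt : Idx → (ℕ+ → ℂ) := Sum.elim ε fun i => -ε i

/-- The signed index `±i`. -/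
def sgn : Idx → ℤ := Sum.elim (fun i => (i : ℤ)) fun i => -(i : ℤ)

/-- The exponent along a signed index: `λ_i` along `i` and `-1 - λ_i` along `-i`. -/
def expo (lam : ℕ+ → ℂ) : Idx → ℂ := Sum.elim lam fun i => -1 - lam i

@[simp] theorem wt_inl (i : ℕ+) : wt (Sum.inl i) = ε i := rfl
@[simp] theorem wt_inr (i : ℕ+) : wt (Sum.inr i) = -ε i := rfl
@[simp] theorem sgn_inl (i : ℕ+) : sgn (Sum.inl i) = i := rfl
@[simp] theorem sgn_inr (i : ℕ+) : sgn (Sum.inr i) = -i := rfl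
@[simp] theorem expo_inl (lam : ℕ+ → ℂ) (i : ℕ+) : expo lam (Sum.inl i) = lam i := rfl
@[simp] theorem expo_inr (lam : ℕ+ → ℂ) (i : ℕ+) : expo lam (Sum.inr i) = -1 - lam i := rfl

theorem wt_swap (a : Idx) : wt a.swap = -wt a := by
  rcases a with i | i <;> simp

theorem sgn_swap (a : Idx) : sgn a.swap = -sgn a := by
  rcases a with i | i <;> simp

theorem exists_sgn {m : ℤ} (hm : m ≠ 0) : ∃ a, sgn a = m := by
  rcases lt_or_gt_of_ne hm with h | h
  · lift -m to ℕ+ using by omega with n hn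
    exact ⟨Sum.inr n, by rw [sgn_inr, hn, neg_neg]⟩
  · lift m to ℕ+ using h with n
    exact ⟨Sum.inl n, rfl⟩

theorem expo_swap (lam : ℕ+ → ℂ) (a : Idx) : expo lam a.swap = -1 - expo lam a := by
  rcases a with i | i <;> simp

theorem expo_add_wt_self (lam : ℕ+ → ℂ) (a : Idx) : expo (lam + wt a) a = expo lam a + 1 := by
  rcases a with i | i <;> simp [ε]; ring

theorem expo_add_wt_swap (lam : ℕ+ → ℂ) (a : Idx) :
    expo (lam + wt a) a.swap = expo lam a.swap - 1 := by
  rw [expo_swap, expo_swap, expo_add_wt_self]; ring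

theorem expo_add_wt_of_ne (lam : ℕ+ → ℂ) {a b : Idx} (h : b ≠ a) (h' : b ≠ a.swap) :
    expo (lam + wt a) b = expo lam b := by
  rcases a with i | i <;> rcases b with j | j <;> simp_all [ε]

theorem wt_add_wt_mem_rootLattice (a b : Idx) : wt a + wt b ∈ rootLattice := by
  rcases a with i | i <;> rcases b with j | j
  · exact add_mem_rootLattice i j
  · simpa [sub_eq_add_neg] using sub_mem_rootLattice i j
  · simpa [sub_eq_add_neg, add_comm] using sub_mem_rootLattice j i
  · simpa [add_comm] using neg_mem (add_mem_rootLattice i j)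

theorem mem_roots_iff {α : ℕ+ → ℂ} : α ∈ roots ↔ ∃ a b, b ≠ a.swap ∧ α = wt a + wt b := by
  constructor
  · rintro (⟨i, rfl | rfl⟩ | ⟨i, j, hij, rfl | rfl | rfl⟩)
    · exact ⟨Sum.inl i, Sum.inl i, by simp, by simp [two_smul]⟩
    · exact ⟨Sum.inr i, Sum.inr i, by simp, by simp [two_smul]⟩
    · exact ⟨Sum.inl i, Sum.inr j, by simp [hij.symm], by simp [sub_eq_add_neg]⟩
    · exact ⟨Sum.inl i, Sum.inl j, by simp, by simp⟩
    · exact ⟨Sum.inr i, Sum.inr j, by simp, by simp [sub_eq_add_neg]⟩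
  · rintro ⟨a, b, hab, rfl⟩
    rcases a with i | i <;> rcases b with j | j
    · rcases eq_or_ne i j with rfl | h
      · exact Or.inl ⟨i, Or.inl (by simp [two_smul])⟩
      · exact Or.inr ⟨i, j, h, by simp⟩
    · exact Or.inr ⟨i, j, fun h => hab (by simp [h]), Or.inl (by simp [sub_eq_add_neg])⟩
    · exact Or.inr ⟨j, i, fun h => hab (by simp [h]), Or.inl (by simp [sub_eq_add_neg, add_comm])⟩
    · rcases eq_or_ne i j with rfl | h
      · exact Or.inl ⟨i, Or.inr (by simp [two_smul])⟩
      · exact Or.inr ⟨i, j, h, Or.inr (Or.inr (by simp [sub_eq_add_neg]))⟩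

/-! ### Equivalent exponents -/

theorem natCast_ne_neg (n m : ℕ) : (n : ℂ) ≠ -1 - m := by
  intro h
  have h1 : ((n + 1 + m : ℕ) : ℂ) = 0 := by push_cast; linear_combination h
  exact absurd (Nat.cast_eq_zero.mp h1) (by omega)

/-- `Int⁺` changes only when an entry crosses between `-1` and `0`. Going up this happens from `λ_i
= -1`, going down from `λ_i = 0`; both read exponent `-1` along the signed index. -/
theorem intPos_add_wt {lam : ℕ+ → ℂ} {a : Idx} (h : expo lam a ≠ -1) :
    intPos (lam + wt a) = intPos lam := by
  ext k
  rcases a with i | i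
  · rcases eq_or_ne k i with rfl | hk
    · constructor
      · rintro ⟨n, hn⟩
        have hn' : lam k + 1 = n := by simpa [ε] using hn
        rcases n with _ | n
        · exact absurd (show expo lam (Sum.inl k) = -1 by
            simp only [expo_inl]; linear_combination hn') h
        · exact ⟨n, by push_cast at hn'; linear_combination hn'⟩
      · rintro ⟨n, hn⟩
        exact ⟨n + 1, by simp [ε, hn]⟩
    · simp [intPos, ε, hk]
  · rcases eq_or_ne k i with rfl | hk
    · constructor
      · rintro ⟨n, hn⟩
        have hn' : lam k + -1 = n := by simpa [ε] using hn
        exact ⟨n + 1, by push_cast; linear_combination hn'⟩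
      · rintro ⟨n, hn⟩
        rcases n with _ | n
        · exact absurd (show expo lam (Sum.inr k) = -1 by
            simp only [expo_inr]; rw [hn]; simp) h
        · exact ⟨n, by simp [ε, hn]⟩
    · simp [intPos, ε, hk]

/-- If the first unit move crosses the boundary between `-1` and `0`, only the opposite unit move
could cross back, and that one is excluded. -/
theorem intPos_add_wt_add_wt_ne {lam : ℕ+ → ℂ} {a b : Idx} (hb : b ≠ a.swap)
    (h : expo lam a = -1) : intPos (lam + wt a + wt b) ≠ intPos lam := by
  intro he
  have key : ∀ i, i ∈ intPos (lam + wt a + wt b) ↔ i ∈ intPos lam := fun i => by rw [he]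
  rcases a with i | i
  · have h0 : i ∉ intPos lam := by
      rintro ⟨n, hn⟩
      rw [expo_inl] at h
      exact natCast_ne_neg n 0 (by rw [← hn, h]; simp)
    refine h0 ((key i).1 ?_)
    simp only [expo_inl] at h
    rcases b with j | j <;> rcases eq_or_ne i j with rfl | hij
    · exact ⟨1, by simp [ε, h]⟩
    · exact ⟨0, by simp [ε, h, hij]⟩
    · simp at hb
    · exact ⟨0, by simp [ε, h, hij]⟩
  · have h' : lam i = 0 := by
      rw [expo_inr] at h; linear_combination -h
    obtain ⟨n, hn⟩ := (key i).2 ⟨0, by simpa using h'⟩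
    rcases b with j | j <;> rcases eq_or_ne i j with rfl | hij
    · simp at hb
    · exact natCast_ne_neg n 0 (by simp [← hn, h', ε, hij])
    · refine natCast_ne_neg n 1 ?_
      simp [← hn, h', ε]
      ring
    · exact natCast_ne_neg n 0 (by simp [← hn, h', ε, hij])

theorem intPos_add_wt_iff {lam : ℕ+ → ℂ} {a : Idx} :
    intPos (lam + wt a) = intPos lam ↔ expo lam a ≠ -1 := by
  refine ⟨fun he h => ?_, intPos_add_wt⟩
  have key : ∀ i, i ∈ intPos (lam + wt a) ↔ i ∈ intPos lam := fun i => by rw [he]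
  rcases a with i | i
  · rw [expo_inl] at h
    obtain ⟨n, hn⟩ := (key i).1 ⟨0, by simp [ε, h]⟩
    exact natCast_ne_neg n 0 (by simp [← hn, h])
  · have h' : lam i = 0 := by rw [expo_inr] at h; linear_combination -h
    obtain ⟨n, hn⟩ := (key i).2 ⟨0, by simpa using h'⟩
    exact natCast_ne_neg n 0 (by simp [← hn, h', ε])

theorem intPos_add_wt_add_wt_iff {lam : ℕ+ → ℂ} {a b : Idx} (hb : b ≠ a.swap) :
    intPos (lam + wt a + wt b) = intPos lam ↔
      expo lam a ≠ -1 ∧ expo (lam + wt a) b ≠ -1 := by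
  by_cases h : expo lam a = -1
  · simp [h, intPos_add_wt_add_wt_ne hb h]
  · rw [← intPos_add_wt h, intPos_add_wt_iff]
    simp [h]

/-- The `∼_sp`-class of `μ`. -/
def cls (μ : ℕ+ → ℂ) : Set (ℕ+ → ℂ) := {lam | lam - μ ∈ rootLattice ∧ intPos lam = intPos μ}

theorem mem_cls {lam μ : ℕ+ → ℂ} : lam ∈ cls μ ↔ SpEquiv lam μ :=
  and_congr_right fun _ => eq_comm

theorem SpEquiv.symm {lam μ : ℕ+ → ℂ} (h : SpEquiv lam μ) : SpEquiv μ lam :=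
  ⟨by simpa using neg_mem h.1, h.2.symm⟩

theorem add_mem_cls {lam μ : ℕ+ → ℂ} (hl : lam ∈ cls μ) {a b : Idx} (hb : b ≠ a.swap) :
    lam + wt a + wt b ∈ cls μ ↔ expo lam a ≠ -1 ∧ expo (lam + wt a) b ≠ -1 := by
  rw [← intPos_add_wt_add_wt_iff hb, hl.2]
  refine and_iff_right ?_
  have := add_mem hl.1 (wt_add_wt_mem_rootLattice a b)
  convert this using 1
  abel

/-! ### Connectedness of a class under root moves -/

/-- A move by a root which does not change the set of nonnegative integral exponents. -/
def RootStep (lam lam' : ℕ+ → ℂ) : Prop :=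
  ∃ a b : Idx, b ≠ a.swap ∧ lam' = lam + wt a + wt b ∧ intPos lam' = intPos lam

/-- The integral version of `wt`. -/
def wtInt : Idx → (ℕ+ →₀ ℤ) :=
  Sum.elim (fun i => Finsupp.single i 1) fun i => -Finsupp.single i 1

/-- A finitely supported integral sequence as a complex sequence. -/
def castSeq : (ℕ+ →₀ ℤ) →+ (ℕ+ → ℂ) where
  toFun d i := d i
  map_zero' := by ext; simp
  map_add' _ _ := by ext; simp

theorem castSeq_apply (d : ℕ+ →₀ ℤ) (i : ℕ+) : castSeq d i = d i := rfl

theorem castSeq_wtInt (a : Idx) : castSeq (wtInt a) = wt a := by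
  ext k
  rcases a with i | i <;> rcases eq_or_ne k i with rfl | h <;>
    simp [castSeq_apply, wtInt, ε, *]

/-- The sum of the entries. -/
def total : (ℕ+ →₀ ℤ) →+ ℤ := Finsupp.liftAddHom fun _ => AddMonoidHom.id ℤ

theorem total_wtInt (a : Idx) : Odd (total (wtInt a)) := by
  have h (i : ℕ+) : total (Finsupp.single i 1) = 1 := by simp [total]
  rcases a with i | i
  · exact (h i).symm ▸ odd_one
  · rw [show wtInt (Sum.inr i) = -Finsupp.single i 1 from rfl, map_neg, h]
    exact odd_neg.2 odd_one

/-- Every root is a sum of two unit vectors up to sign, so the entries of a root lattice element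
have an even sum. This parity is what later lets unit moves be paired into roots. -/
theorem exists_castSeq {q : ℕ+ → ℂ} (hq : q ∈ rootLattice) :
    ∃ d, castSeq d = q ∧ Even (total d) := by
  induction hq using AddSubgroup.closure_induction with
  | mem x hx =>
    obtain ⟨a, b, -, rfl⟩ := mem_roots_iff.1 hx
    exact ⟨wtInt a + wtInt b, by simp [castSeq_wtInt],
      by rw [map_add]; exact (total_wtInt a).add_odd (total_wtInt b)⟩
  | zero => exact ⟨0, by simp⟩
  | add x y _ _ hx hy =>
    obtain ⟨d, rfl, hd⟩ := hx
    obtain ⟨d', rfl, hd'⟩ := hy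
    exact ⟨d + d', map_add _ _ _, by rw [map_add]; exact hd.add hd'⟩
  | neg x _ hx =>
    obtain ⟨d, rfl, hd⟩ := hx
    exact ⟨-d, map_neg _ _, by rw [map_neg]; exact hd.neg⟩

/-- The sum of the absolute values of the entries. -/
def size (d : ℕ+ →₀ ℤ) : ℕ := d.sum fun _ n => n.natAbs

theorem size_lt {d d' : ℕ+ →₀ ℤ} (i : ℕ+) (hi : (d' i).natAbs < (d i).natAbs)
    (hne : ∀ k, k ≠ i → d' k = d k) : size d' < size d := by
  classical
  have h1 : d'.support ⊆ d.support := fun k hk => by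
    rcases eq_or_ne k i with rfl | h
    · rw [Finsupp.mem_support_iff]; omega
    · rw [Finsupp.mem_support_iff, hne k h] at hk; simpa using hk
  rw [size, size, Finsupp.sum_of_support_subset d' h1 _ (by simp), Finsupp.sum]
  refine Finset.sum_lt_sum (fun k _ => ?_) ⟨i, ?_, hi⟩
  · rcases eq_or_ne k i with rfl | h
    · exact hi.le
    · rw [hne k h]
  · rw [Finsupp.mem_support_iff]; omega

/-- Every nonzero difference of equivalent exponents can be shortened by a unit move. -/
theorem exists_unit_move {d : ℕ+ →₀ ℤ} (hd : d ≠ 0) (lam : ℕ+ → ℂ)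
    (h : intPos (lam + castSeq d) = intPos lam) :
    ∃ a, size (d - wtInt a) < size d ∧ intPos (lam + wt a) = intPos lam ∧
      (match a with | Sum.inl i => 0 < d i | Sum.inr i => d i < 0) := by
  obtain ⟨i, hi⟩ := Finsupp.ne_iff.1 hd
  rw [Finsupp.zero_apply] at hi
  have key : i ∈ intPos (lam + castSeq d) ↔ i ∈ intPos lam := by rw [h]
  rcases lt_or_gt_of_ne hi with hi | hi
  · refine ⟨Sum.inr i, size_lt i ?_ fun k hk => ?_, intPos_add_wt fun he => ?_, hi⟩
    · simp [wtInt]; omega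
    · simp [wtInt, hk.symm]
    -- A forbidden step down would start at entry `0`, but the target entry is then `d i < 0`, so
    -- the endpoints would disagree on `Int⁺` at `i`. Dually, a forbidden step up starts at `-1` and
    -- ends at `d i - 1 ≥ 0`.
    · have h' : lam i = 0 := by rw [expo_inr] at he; linear_combination -he
      obtain ⟨n, hn⟩ := key.2 ⟨0, by simpa using h'⟩
      refine natCast_ne_neg n (-1 - d i).toNat ?_
      rw [← hn, Pi.add_apply, h', castSeq_apply, ← Int.cast_natCast, Int.toNat_of_nonneg (by omega)]
      push_cast; ring
  · refine ⟨Sum.inl i, size_lt i ?_ fun k hk => ?_, intPos_add_wt fun he => ?_, hi⟩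
    · simp [wtInt]; omega
    · simp [wtInt, hk.symm]
    · rw [expo_inl] at he
      obtain ⟨n, hn⟩ := key.1 ⟨(d i - 1).toNat, by
        rw [Pi.add_apply, he, castSeq_apply, ← Int.cast_natCast (R := ℂ),
          Int.toNat_of_nonneg (by omega)]
        push_cast; ring⟩
      exact natCast_ne_neg n 0 (by simp [← hn, he])

/-- Induction on the size of the difference. After one unit move towards the target the remaining
difference has odd sum, hence is nonzero, so a second unit move is available; together the two make
a root. -/
theorem rootStep_connected (d : ℕ+ →₀ ℤ) (lam : ℕ+ → ℂ) (hd : Even (total d))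
    (h : intPos (lam + castSeq d) = intPos lam) :
    Relation.ReflTransGen RootStep lam (lam + castSeq d) := by
  induction hn : size d using Nat.strong_induction_on generalizing d lam with
  | _ n ih =>
  subst hn
  rcases eq_or_ne d 0 with rfl | hd0
  · simpa using Relation.ReflTransGen.refl
  obtain ⟨a, ha, hla, hda⟩ := exists_unit_move hd0 lam h
  have hodd : Odd (total (d - wtInt a)) := by
    rw [map_sub]; exact hd.sub_odd (total_wtInt a)
  have hd1 : d - wtInt a ≠ 0 := by
    intro h0
    rw [h0, map_zero] at hodd
    exact absurd hodd (by decide)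
  have hcast : ∀ (x : ℕ+ → ℂ) (d : ℕ+ →₀ ℤ) (a : Idx),
      x + wt a + castSeq (d - wtInt a) = x + castSeq d := fun x d a => by
    rw [map_sub, castSeq_wtInt]; abel
  obtain ⟨b, hb, hlb, hdb⟩ := exists_unit_move hd1 (lam + wt a) (by rw [hcast, h, hla])
  have hne : b ≠ a.swap := by
    -- Both moves go towards the target, so the second cannot undo the first: the remaining
    -- difference at that index has not changed sign.
    rintro rfl
    rcases a with i | i <;> simp [wtInt] at hda hdb <;> omega
  have hstep : RootStep lam (lam + wt a + wt b) := ⟨a, b, hne, rfl, hlb.trans hla⟩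
  have := ih _ (hb.trans ha) (d - wtInt a - wtInt b) (lam + wt a + wt b)
    (by rw [map_sub]; exact hodd.sub_odd (total_wtInt b))
    (by rw [hcast, hcast, h, hlb, hla]) rfl
  rw [hcast, hcast] at this
  exact this.head hstep

theorem rootStep_connected_of_mem_cls {lam lam' μ : ℕ+ → ℂ} (h : lam ∈ cls μ) (h' : lam' ∈ cls μ) :
    Relation.ReflTransGen RootStep lam lam' := by
  have hq : lam' - lam ∈ rootLattice := by simpa using sub_mem h'.1 h.1
  obtain ⟨d, hd, hev⟩ := exists_castSeq hq
  have hl : lam + castSeq d = lam' := by rw [hd]; abel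
  rw [← hl]
  exact rootStep_connected d lam hev (by rw [hl, h'.2, h.2])

/-! ### Admissible `ℤ₂`-linear orders -/

/-- An admissible `ℤ₂`-linear strict partial order on `ℤ`. -/
structure IsAdmissibleOrder (r : ℤ → ℤ → Prop) : Prop where
  irrefl : ∀ i, ¬ r i i
  trans : ∀ i j k, r i j → r j k → r i k
  admissible : IsAdmissible r
  z2 : IsZ2Linear r

variable {r : ℤ → ℤ → Prop}

theorem self_mem_block (r : ℤ → ℤ → Prop) (i : ℤ) : i ∈ block r i := Or.inl rfl

namespace IsAdmissibleOrder

variable (hr : IsAdmissibleOrder r)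

include hr

theorem mem_block {i j : ℤ} : j ∈ block r i ↔ ¬ r i j ∧ ¬ r j i :=
  ⟨fun h => h.elim (fun h => h ▸ ⟨hr.irrefl _, hr.irrefl _⟩) id, Or.inr⟩

theorem block_eq {i j : ℤ} (h : j ∈ block r i) : block r i = block r j := by
  by_contra hne
  have := hr.admissible i j hne
  exact (Set.mem_empty_iff_false j).1 (this ▸ ⟨h, self_mem_block r j⟩)

/-- Admissibility makes incomparability an equivalence relation. An element `j` failing both
alternatives would be incomparable with `i` and with `k`, putting `i ≺ k` in one block. -/
theorem cotrans {i k : ℤ} (h : r i k) (j : ℤ) : r i j ∨ r j k := by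
  by_contra! hn
  have h1 : j ∈ block r i := hr.mem_block.2 ⟨hn.1, fun h' => hn.2 (hr.trans _ _ _ h' h)⟩
  have h2 : k ∈ block r j := hr.mem_block.2 ⟨hn.2, fun h' => hn.1 (hr.trans _ _ _ h h')⟩
  rw [← hr.block_eq h1, hr.mem_block] at h2
  exact h2.1 h

theorem asymm {i j : ℤ} (h : r i j) : ¬ r j i := fun h' => hr.irrefl _ (hr.trans _ _ _ h h')

theorem neg_iff {i j : ℤ} : r (-i) (-j) ↔ r j i :=
  ⟨fun h => by simpa using hr.z2 _ _ h, hr.z2 _ _⟩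

theorem zero_lt_neg {i : ℤ} : r 0 (-i) ↔ r i 0 := by
  simpa using hr.neg_iff (i := 0) (j := i)

theorem neg_lt_zero {i : ℤ} : r (-i) 0 ↔ r 0 i := by
  simpa using hr.neg_iff (i := i) (j := 0)

theorem lt_neg_self {i : ℤ} : r i (-i) ↔ r i 0 := by
  refine ⟨fun h => ?_, fun h => hr.trans _ _ _ h (hr.zero_lt_neg.2 h)⟩
  exact (hr.cotrans h 0).elim id hr.zero_lt_neg.1

theorem setLT_block {i j : ℤ} : SetLT r (block r i) (block r j) ↔ r i j := by
  refine ⟨fun h => h _ (self_mem_block r i) _ (self_mem_block r j), fun h a ha b hb => ?_⟩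
  have ha' := hr.mem_block.1 ha
  have hb' := hr.mem_block.1 hb
  have h1 : r a j := (hr.cotrans h a).resolve_left ha'.1
  exact (hr.cotrans h1 b).resolve_right hb'.2

theorem block_mem_blocksBelow {i : ℤ} : block r i ∈ blocksBelow r ↔ r i 0 :=
  ⟨fun h => hr.setLT_block.1 h.2, fun h => ⟨⟨i, rfl⟩, hr.setLT_block.2 h⟩⟩

theorem block_mem_blocksAbove {i : ℤ} : block r i ∈ blocksAbove r ↔ r 0 i :=
  ⟨fun h => hr.setLT_block.1 h.2, fun h => ⟨⟨i, rfl⟩, hr.setLT_block.2 h⟩⟩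

theorem isMaxBlock_block {i : ℤ} : IsMaxBlock r (blocksBelow r) (block r i) ↔
    r i 0 ∧ ∀ m, r i m → ¬ r m 0 := by
  refine and_congr hr.block_mem_blocksBelow ⟨fun h m him hm => ?_, ?_⟩
  · exact h _ (hr.block_mem_blocksBelow.2 hm) (hr.setLT_block.2 him)
  · rintro h _ ⟨⟨m, rfl⟩, hm⟩ him
    exact h m (hr.setLT_block.1 him) (hr.setLT_block.1 hm)

theorem isMinBlock_block {i : ℤ} : IsMinBlock r (blocksAbove r) (block r i) ↔
    r 0 i ∧ ∀ m, r m i → ¬ r 0 m := by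
  refine and_congr hr.block_mem_blocksAbove ⟨fun h m him hm => ?_, ?_⟩
  · exact h _ (hr.block_mem_blocksAbove.2 hm) (hr.setLT_block.2 him)
  · rintro h _ ⟨⟨m, rfl⟩, hm⟩ him
    exact h m (hr.setLT_block.1 him) (hr.setLT_block.1 hm)

theorem isMinBlock_neg {i : ℤ} : IsMinBlock r (blocksAbove r) (block r (-i)) ↔
    IsMaxBlock r (blocksBelow r) (block r i) := by
  rw [hr.isMinBlock_block, hr.isMaxBlock_block, hr.zero_lt_neg]
  refine and_congr_right fun _ => ⟨fun h m him hm => ?_, fun h m him hm => ?_⟩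
  · exact h (-m) (hr.neg_iff.2 him) (hr.zero_lt_neg.2 hm)
  · exact h (-m) (by simpa using hr.neg_iff.2 him) (hr.neg_lt_zero.2 hm)

/-- The map `i ↦ -i` carries a maximal block below `[0]` to a minimal block above it and conversely,
so the mixed cases of the criterion are vacuous. -/
theorem max_or_not :
    (¬ (∃ B, IsMaxBlock r (blocksBelow r) B) ∧ ¬ (∃ B, IsMinBlock r (blocksAbove r) B)) ∨
      ∃ B₁ B₂, IsMaxBlock r (blocksBelow r) B₁ ∧ IsMinBlock r (blocksAbove r) B₂ := by
  by_cases h : ∃ B, IsMaxBlock r (blocksBelow r) B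
  · obtain ⟨B, hB⟩ := h
    obtain ⟨i, rfl⟩ := hB.1.1
    exact Or.inr ⟨_, _, hB, hr.isMinBlock_neg.2 hB⟩
  · refine Or.inl ⟨h, ?_⟩
    rintro ⟨B, hB⟩
    obtain ⟨i, rfl⟩ := hB.1.1
    rw [← neg_neg i] at hB
    exact h ⟨_, hr.isMinBlock_neg.1 hB⟩

/-! ### Positive roots by signed indices -/

theorem mem_posRoots {α : ℕ+ → ℂ} :
    α ∈ posRoots r ↔ ∃ a b, r (sgn a) (-sgn b) ∧ α = wt a + wt b := by
  constructor
  · rintro (⟨i, hi, rfl⟩ | ⟨i, hi, rfl⟩ | ⟨i, j, h, rfl⟩ | ⟨i, j, h, rfl⟩ | ⟨i, j, h, rfl⟩)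
    · exact ⟨Sum.inl i, Sum.inl i, hr.lt_neg_self.2 hi, by simp [two_smul]⟩
    · exact ⟨Sum.inr i, Sum.inr i, hr.lt_neg_self.2 hi, by simp [two_smul]⟩
    · exact ⟨Sum.inl i, Sum.inr j, by simpa using h, by simp [sub_eq_add_neg]⟩
    · exact ⟨Sum.inl i, Sum.inl j, by simpa using h, by simp⟩
    · exact ⟨Sum.inr i, Sum.inr j, by simpa using h, by simp [sub_eq_add_neg]⟩
  · rintro ⟨a, b, hab, rfl⟩
    rcases a with i | i <;> rcases b with j | j
    · exact Or.inr (Or.inr (Or.inr (Or.inl ⟨i, j, hab, rfl⟩)))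
    · exact Or.inr (Or.inr (Or.inl ⟨i, j, by simpa using hab, by simp [sub_eq_add_neg]⟩))
    · exact Or.inr (Or.inr (Or.inl ⟨j, i, hr.neg_iff.1 (by simpa using hab),
        by simp [sub_eq_add_neg, add_comm]⟩))
    · exact Or.inr (Or.inr (Or.inr (Or.inr ⟨i, j, by simpa using hab,
        by simp [sub_eq_add_neg]⟩)))

theorem ne_swap_of_lt {a b : Idx} (h : r (sgn a) (-sgn b)) : b ≠ a.swap := by
  rintro rfl
  rw [sgn_swap, neg_neg] at h
  exact hr.irrefl _ h

theorem exists_of_mem_zeroRoots {α : ℕ+ → ℂ} (h : α ∈ zeroRoots r) :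
    ∃ a b, b ≠ a.swap ∧ α = wt a + wt b ∧ ¬ r (sgn a) (-sgn b) ∧ ¬ r (-sgn b) (sgn a) := by
  obtain ⟨hα, h1, h2⟩ := h
  obtain ⟨a, b, hab, rfl⟩ := mem_roots_iff.1 hα
  refine ⟨a, b, hab, rfl, fun hn => h1 (hr.mem_posRoots.2 ⟨a, b, hn, rfl⟩), fun hn => h2 ?_⟩
  refine hr.mem_posRoots.2 ⟨b.swap, a.swap, ?_, ?_⟩
  · simpa [sgn_swap] using hn
  · rw [wt_swap, wt_swap]; abel

end IsAdmissibleOrder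

/-! ### Exponents of singular monomials -/

/-- Membership in `R(≺)`, by signed indices. -/
def IsStd (r : ℤ → ℤ → Prop) (lam : ℕ+ → ℂ) : Prop := ∀ a, r (sgn a) 0 → expo lam a = -1

/-- `lam` is equal to `ω - wt k`, with `ω ∈ R(≺)`, and `k` is in the largest block below `[0]`,
which is `{0}`. -/
def IsExceptional (r : ℤ → ℤ → Prop) (lam : ℕ+ → ℂ) : Prop :=
  (∀ a, r (sgn a) 0 ∨ r 0 (sgn a)) ∧
    ∃ k, r (sgn k) 0 ∧ (∀ m, r (sgn k) m → ¬ r m 0) ∧ IsStd r (lam + wt k)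

/-- No positive root moves `lam` within its class. -/
def IsExtremal (r : ℤ → ℤ → Prop) (μ lam : ℕ+ → ℂ) : Prop :=
  lam ∈ cls μ ∧ ∀ α ∈ posRoots r, lam + α ∉ cls μ

namespace IsAdmissibleOrder

variable (hr : IsAdmissibleOrder r)

include hr

/-- An entry `0` at an index `k ≻ 0` is an exponent `-1` along `-k ≺ 0`, so the two conditions that
define `R(≺)` become one. -/
theorem mem_R_iff {ω : ℕ+ → ℂ} : ω ∈ R r ↔ IsStd r ω := by
  constructor
  · rintro ⟨h1, h2⟩ (i | i) ha
    · exact h1 _ (hr.block_mem_blocksBelow.2 ha) i (self_mem_block r _)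
    · have := h2 _ (hr.block_mem_blocksAbove.2 (hr.neg_lt_zero.1 ha)) i (self_mem_block r _)
      simp [this]
  · refine fun h => ⟨fun B hB k hk => ?_, fun B hB k hk => ?_⟩
    · exact h (Sum.inl k) (hB.2 _ hk _ (self_mem_block r 0))
    · have := h (Sum.inr k) (hr.neg_lt_zero.2 (hB.2 _ (self_mem_block r 0) _ hk))
      rw [expo_inr] at this
      linear_combination -this

theorem isExtremal_iff_forall {μ lam : ℕ+ → ℂ} (hl : lam ∈ cls μ) :
    IsExtremal r μ lam ↔ ∀ a b, r (sgn a) (-sgn b) →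
      expo lam a = -1 ∨ expo (lam + wt a) b = -1 := by
  refine ⟨fun h a b hab => ?_, fun h => ⟨hl, fun α hα hn => ?_⟩⟩
  · have := h.2 _ (hr.mem_posRoots.2 ⟨a, b, hab, rfl⟩)
    rw [← add_assoc, add_mem_cls hl (hr.ne_swap_of_lt hab)] at this
    tauto
  · obtain ⟨a, b, hab, rfl⟩ := hr.mem_posRoots.1 hα
    rw [← add_assoc, add_mem_cls hl (hr.ne_swap_of_lt hab)] at hn
    have := h a b hab
    tauto

/-- Let `k ≺ 0` have exponent other than `-1`. Extremality for the root `2 wt k` forces exponent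
`-2` along `k`, and for `wt k + wt b` it forces `-1` along every other `b` with `k ≺ -b`. Exponents
along `c` and `-c` add to `-1`, so they are never both `-1`; this leaves no room between `k` and
`0`, nor in `[0]` beyond `0`. -/
theorem isStd_or_isExceptional {μ lam : ℕ+ → ℂ} (h : IsExtremal r μ lam) :
    IsStd r lam ∨ IsExceptional r lam := by
  have h' := (hr.isExtremal_iff_forall h.1).1 h
  by_cases hs : IsStd r lam
  · exact Or.inl hs
  right
  simp only [IsStd, not_forall] at hs
  obtain ⟨k, hk, hlk⟩ := hs
  have hb : ∀ b, b ≠ k → r (sgn k) (-sgn b) → expo lam b = -1 := fun b hbk hkb => by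
    have := (h' k b hkb).resolve_left hlk
    rwa [expo_add_wt_of_ne lam hbk (hr.ne_swap_of_lt hkb)] at this
  have hkk : expo lam k + 1 = -1 := by
    have := (h' k k (hr.lt_neg_self.2 hk)).resolve_left hlk
    rwa [expo_add_wt_self] at this
  have hc : ∀ c, r (sgn k) (sgn c) → ¬ r (sgn k) (-sgn c) := fun c h1 h2 => by
    have hck : c ≠ k := by rintro rfl; exact hr.irrefl _ h1
    have hck' : c.swap ≠ k := by rintro rfl; rw [sgn_swap] at h2; exact hr.irrefl _ h2
    have e1 := hb c hck h2
    have e2 := hb c.swap hck' (by rwa [sgn_swap, neg_neg])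
    rw [expo_swap, e1] at e2
    norm_num at e2
  refine ⟨fun a => ?_, k, hk, fun m hkm hm => ?_, fun a ha => ?_⟩
  -- A nonzero index incomparable with `0`, and its negative, both lie above `k`, contradicting
  -- `hc`.
  · by_contra! hn
    refine hc a ((hr.cotrans hk _).resolve_right hn.1) ((hr.cotrans hk _).resolve_right ?_)
    rw [hr.neg_lt_zero]
    exact hn.2
  · obtain ⟨c, rfl⟩ := exists_sgn (m := m) (by rintro rfl; exact hr.irrefl _ hm)
    -- If `k ≺ c ≺ 0`, then also `k ≺ 0 ≺ -c`.
    exact hc c hkm (hr.trans _ _ _ hk (hr.zero_lt_neg.2 hm))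
  · rcases eq_or_ne a k with rfl | hak
    · rw [expo_add_wt_self, hkk]
    · have h1 := hr.trans _ _ _ hk (hr.zero_lt_neg.2 ha)
      rw [expo_add_wt_of_ne lam hak (hr.ne_swap_of_lt h1)]
      exact hb a hak h1

/-- If `a ≺ -b`, then `a ≺ 0` or `b ≺ 0`, so one of the two unit moves is blocked. It is still
blocked if it comes second, because the first then moves another index. -/
theorem isExtremal_of_isStd {μ lam : ℕ+ → ℂ} (hl : lam ∈ cls μ) (h : IsStd r lam) :
    IsExtremal r μ lam := by
  rw [hr.isExtremal_iff_forall hl]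
  intro a b hab
  by_cases ha : r (sgn a) 0
  · exact Or.inl (h a ha)
  right
  have hb : r (sgn b) 0 := hr.zero_lt_neg.1 ((hr.cotrans hab 0).resolve_left ha)
  rw [expo_add_wt_of_ne lam (by rintro rfl; exact ha hb) (hr.ne_swap_of_lt hab)]
  exact h b hb

theorem isExtremal_of_isExceptional {μ lam : ℕ+ → ℂ} (hl : lam ∈ cls μ)
    (h : IsExceptional r lam) : IsExtremal r μ lam := by
  obtain ⟨hc, k, hk, hmax, hstd⟩ := h
  have hstd' : ∀ a, r (sgn a) 0 → a ≠ k → expo lam a = -1 := fun a ha hak => by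
    rw [← hstd a ha, expo_add_wt_of_ne lam hak]
    rintro rfl
    rw [sgn_swap, hr.neg_lt_zero] at ha
    exact hr.asymm hk ha
  have hkk : expo lam k + 1 = -1 := by rw [← hstd k hk, expo_add_wt_self]
  -- If `0 ≺ b`, then `k ≺ -b ≺ 0`, against the maximality of `k`. Hence the only partners of `k` in
  -- a positive root are below `0`, where every exponent other than the one along `k` is `-1`.
  have hpart : ∀ b, r (sgn k) (-sgn b) → r (sgn b) 0 := fun b hb =>
    (hc b).resolve_right fun h0 => hmax _ hb (hr.neg_lt_zero.2 h0)
  rw [hr.isExtremal_iff_forall hl]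
  intro a b hab
  have hne := hr.ne_swap_of_lt hab
  rcases eq_or_ne a k with rfl | hak
  · right
    rcases eq_or_ne b a with rfl | hba
    · rw [expo_add_wt_self, hkk]
    · rw [expo_add_wt_of_ne lam hba hne]
      exact hstd' b (hpart b hab) hba
  by_cases ha : r (sgn a) 0
  · exact Or.inl (hstd' a ha hak)
  have hb : r (sgn b) 0 := hr.zero_lt_neg.1 ((hr.cotrans hab 0).resolve_left ha)
  rcases eq_or_ne b k with rfl | hbk
  · exact absurd (hpart a (by simpa using hr.neg_iff.2 hab)) ha
  · right
    rw [expo_add_wt_of_ne lam (by rintro rfl; exact ha hb) hne]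
    exact hstd' b hb hbk

/-- A Levi move inside the class needs exponents other than `-1` along both `a` and `b`. For an
element of `R(≺)` this puts both indices in `[0]`, where `R(≺)` imposes nothing. In the exceptional
case one of them must be `k`, and the move only replaces `k` by another index of its block. -/
theorem isExtremal_add_wt_add_wt {μ lam : ℕ+ → ℂ} (h : IsExtremal r μ lam) {a b : Idx}
    (hne : b ≠ a.swap) (h1 : ¬ r (sgn a) (-sgn b)) (h2 : ¬ r (-sgn b) (sgn a))
    (hl : lam + wt a + wt b ∈ cls μ) : IsExtremal r μ (lam + wt a + wt b) := by
  obtain ⟨ha, hb⟩ := (add_mem_cls h.1 hne).1 hl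
  -- The sum of the two unit moves does not depend on their order, so the criterion also applies
  -- with `b` first.
  obtain ⟨hb', ha'⟩ : expo lam b ≠ -1 ∧ expo (lam + wt b) a ≠ -1 := by
    rw [← add_mem_cls h.1 (by rintro rfl; simp at hne), add_right_comm]
    exact hl
  rcases hr.isStd_or_isExceptional h with hs | ⟨hc, k, hk, hmax, hstd⟩
  · refine hr.isExtremal_of_isStd hl fun c hcc => ?_
    have ha0 : ¬ r (sgn a) 0 := fun h0 => ha (hs a h0)
    have hb0 : ¬ r (sgn b) 0 := fun h0 => hb' (hs b h0)
    have ha1 : ¬ r 0 (sgn a) := fun h0 => (hr.cotrans h0 (-sgn b)).elim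
      (fun h3 => hb0 (hr.zero_lt_neg.1 h3)) h2
    have hb1 : ¬ r 0 (sgn b) := fun h0 => (hr.cotrans (hr.neg_lt_zero.2 h0) (sgn a)).elim h2 ha0
    have hca : ∀ x : Idx, ¬ r (sgn x) 0 → c ≠ x := fun x hx => by rintro rfl; exact hx hcc
    have hsw : ∀ x : Idx, ¬ r 0 (sgn x) → ¬ r (sgn x.swap) 0 := fun x hx => by
      rwa [sgn_swap, hr.neg_lt_zero]
    rw [expo_add_wt_of_ne _ (hca b hb0) (hca _ (hsw b hb1)),
      expo_add_wt_of_ne _ (hca a ha0) (hca _ (hsw a ha1))]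
    exact hs c hcc
  · refine hr.isExtremal_of_isExceptional hl ⟨hc, ?_⟩
    have hsw : ∀ x y : Idx, ¬ r (sgn x) (-sgn y) → ¬ r (-sgn y) (sgn x) → r (sgn x) 0 →
        (∀ m, r (sgn x) m → ¬ r m 0) → IsStd r (lam + wt x) →
        ∃ k, r (sgn k) 0 ∧ (∀ m, r (sgn k) m → ¬ r m 0) ∧
          IsStd r (lam + wt x + wt y + wt k) := fun x y hxy hyx hx hm hs => by
      -- The new exceptional index is `-y`, incomparable with `x`: adding `wt y` and then `wt (-y)`
      -- returns to `lam + wt x`, which is in `R(≺)`.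
      refine ⟨y.swap, ?_, fun m hym => hm m ?_, ?_⟩
      · rw [sgn_swap]; exact (hr.cotrans hx _).resolve_left hxy
      · rw [sgn_swap] at hym; exact (hr.cotrans hym (sgn x)).resolve_left hyx
      · rwa [wt_swap, add_neg_cancel_right]
    have hno : ∀ x : Idx, x ≠ k → expo lam x ≠ -1 → r 0 (sgn x) := fun x hx hlx => by
      refine (hc x).resolve_left fun h0 => hlx ?_
      rw [← hstd x h0, expo_add_wt_of_ne lam hx]
      rintro rfl
      rw [sgn_swap, hr.neg_lt_zero] at h0
      exact hr.asymm hk h0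
    rcases eq_or_ne a k with rfl | hak
    · exact hsw a b h1 h2 hk hmax hstd
    rcases eq_or_ne b k with rfl | hbk
    · rw [add_right_comm]
      refine hsw b a (fun h3 => ?_) (fun h3 => ?_) hk hmax hstd
      · exact h1 (by simpa using hr.neg_iff.2 h3)
      · exact h2 (by simpa using hr.neg_iff.2 h3)
    · exact absurd (hr.trans _ _ _ (hr.neg_lt_zero.2 (hno b hbk hb')) (hno a hak ha)) h2

/-! ### The criterion in terms of extremal exponents -/

/-- If `[0] = {0}`, then `ω - wt k` is itself exceptional. Otherwise the root `wt d + wt k`, with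
`d` in `[0]` of exponent `0`, moves it to `ω + wt d`, which is in `R(≺)`. The hypothesis `hzero`
supplies `d` for both signs: `ω(+)` has exponent `0` along positive indices of `[0]`, `ω(-)` along
negative ones. -/
theorem exists_isExtremal_of_sub {μ ω : ℕ+ → ℂ} (hω : IsStd r ω) {k : Idx} (hk : r (sgn k) 0)
    (hmax : ∀ m, r (sgn k) m → ¬ r m 0)
    (hzero : ∀ c, ¬ r (sgn c) 0 → ¬ r 0 (sgn c) → ∃ c', ¬ r (sgn c') 0 ∧ ¬ r 0 (sgn c') ∧
      expo ω c' = 0)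
    (hμ : ω + wt k.swap ∈ cls μ) : ∃ lam, IsExtremal r μ lam := by
  by_cases hc : ∀ a, r (sgn a) 0 ∨ r 0 (sgn a)
  · refine ⟨_, hr.isExtremal_of_isExceptional hμ ⟨hc, k, hk, hmax, ?_⟩⟩
    rwa [wt_swap, neg_add_cancel_right]
  push Not at hc
  obtain ⟨c, hc1, hc2⟩ := hc
  obtain ⟨d, hd1, hd2, hd⟩ := hzero c hc1 hc2
  have hdk : d ≠ k := by rintro rfl; exact hd1 hk
  have hdk' : d ≠ k.swap := by rintro rfl; rw [sgn_swap, hr.zero_lt_neg] at hd2; exact hd2 hk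
  have hkd : k ≠ d.swap := by rintro rfl; simp at hdk'
  refine ⟨ω + wt k.swap + wt d + wt k, hr.isExtremal_of_isStd ?_ ?_⟩
  · rw [add_mem_cls hμ hkd, expo_add_wt_of_ne _ hdk' (by simpa using hdk), hd,
      expo_add_wt_of_ne _ hdk.symm hkd]
    -- Along `k` the exponent is `-1 - 1 = -2` after the subtraction, so adding `wt k` is allowed.
    have := expo_add_wt_swap ω k.swap
    rw [Sum.swap_swap, hω k hk] at this
    rw [this]
    norm_num
  · have : ω + wt k.swap + wt d + wt k = ω + wt d := by rw [wt_swap]; abel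
    rw [this]
    intro a ha
    rw [expo_add_wt_of_ne, hω a ha]
    · rintro rfl; exact hd1 ha
    · rintro rfl; rw [sgn_swap, hr.neg_lt_zero] at ha; exact hd2 ha

theorem exists_isExtremal_of_equivOmegaPlus {μ : ℕ+ → ℂ} {B : Set ℤ}
    (hB : IsMaxBlock r (blocksBelow r) B) (h : EquivOmegaPlus r μ B) :
    ∃ lam, IsExtremal r μ lam := by
  obtain ⟨ω, ⟨hω, hω0⟩, i, hi, hμ⟩ := h
  obtain ⟨j, rfl⟩ := hB.1.1
  rw [hr.block_eq hi, hr.isMaxBlock_block] at hB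
  refine hr.exists_isExtremal_of_sub (k := Sum.inl i) (hr.mem_R_iff.1 hω) hB.1 hB.2
    (fun c h1 h2 => ?_) (mem_cls.2 (by simpa [sub_eq_add_neg] using hμ.symm))
  rcases c with c | c
  · exact ⟨Sum.inl c, h1, h2, hω0 c (hr.mem_block.2 ⟨h2, h1⟩)⟩
  · rw [sgn_inr, hr.neg_lt_zero] at h1
    rw [sgn_inr, hr.zero_lt_neg] at h2
    exact ⟨Sum.inl c, h2, h1, hω0 c (hr.mem_block.2 ⟨h1, h2⟩)⟩

theorem exists_isExtremal_of_equivOmegaMinus {μ : ℕ+ → ℂ} {B : Set ℤ}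
    (hB : IsMinBlock r (blocksAbove r) B) (h : EquivOmegaMinus r μ B) :
    ∃ lam, IsExtremal r μ lam := by
  obtain ⟨ω, ⟨hω, hω0⟩, i, hi, hμ⟩ := h
  obtain ⟨j, rfl⟩ := hB.1.1
  rw [hr.block_eq hi, ← neg_neg (i : ℤ), hr.isMinBlock_neg, hr.isMaxBlock_block] at hB
  refine hr.exists_isExtremal_of_sub (k := Sum.inr i) (hr.mem_R_iff.1 hω) hB.1 hB.2
    (fun c h1 h2 => ?_) (mem_cls.2 (by simpa using hμ.symm))
  rcases c with c | c
  · refine ⟨Sum.inr c, ?_, ?_, by simp [hω0 c (hr.mem_block.2 ⟨h2, h1⟩)]⟩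
    · rwa [sgn_inr, hr.neg_lt_zero]
    · rwa [sgn_inr, hr.zero_lt_neg]
  · refine ⟨Sum.inr c, h1, h2, ?_⟩
    rw [sgn_inr, hr.neg_lt_zero] at h1
    rw [sgn_inr, hr.zero_lt_neg] at h2
    simp [hω0 c (hr.mem_block.2 ⟨h1, h2⟩)]

theorem exists_isExtremal_iff {μ : ℕ+ → ℂ} : (∃ lam, IsExtremal r μ lam) ↔
    ((¬ (∃ B, IsMaxBlock r (blocksBelow r) B) ∧ ¬ (∃ B, IsMinBlock r (blocksAbove r) B) ∧
        ∃ ω ∈ Rmu r μ, SpEquiv μ ω) ∨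
      (∃ B, IsMaxBlock r (blocksBelow r) B ∧ ¬ (∃ C, IsMinBlock r (blocksAbove r) C) ∧
        (EquivOmegaPlus r μ B ∨ ∃ ω ∈ Rmu r μ, SpEquiv μ ω)) ∨
      (∃ B, IsMinBlock r (blocksAbove r) B ∧ ¬ (∃ C, IsMaxBlock r (blocksBelow r) C) ∧
        (EquivOmegaMinus r μ B ∨ ∃ ω ∈ Rmu r μ, SpEquiv μ ω)) ∨
      (∃ B₁ B₂, IsMaxBlock r (blocksBelow r) B₁ ∧ IsMinBlock r (blocksAbove r) B₂ ∧
        (EquivOmegaPlus r μ B₁ ∨ EquivOmegaMinus r μ B₂ ∨ ∃ ω ∈ Rmu r μ, SpEquiv μ ω))) := by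
  have hR : (∃ ω ∈ Rmu r μ, SpEquiv μ ω) → ∃ lam, IsExtremal r μ lam := by
    rintro ⟨ω, hω, -⟩
    exact ⟨ω, hr.isExtremal_of_isStd (mem_cls.2 hω.2) (hr.mem_R_iff.1 hω.1)⟩
  constructor
  · rintro ⟨lam, hlam⟩
    rcases hr.isStd_or_isExceptional hlam with hs | ⟨hc, k, hk, hmax, hstd⟩
    · have hl := mem_cls.1 hlam.1
      have hex : ∃ ω ∈ Rmu r μ, SpEquiv μ ω := ⟨lam, ⟨hr.mem_R_iff.2 hs, hl⟩, hl.symm⟩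
      rcases hr.max_or_not with ⟨h1, h2⟩ | ⟨B₁, B₂, h1, h2⟩
      · exact Or.inl ⟨h1, h2, hex⟩
      · exact Or.inr (Or.inr (Or.inr ⟨B₁, B₂, h1, h2, Or.inr (Or.inr hex)⟩))
    · have hmaxB := hr.isMaxBlock_block.2 ⟨hk, hmax⟩
      refine Or.inr (Or.inr (Or.inr ⟨_, _, hmaxB, hr.isMinBlock_neg.2 hmaxB, ?_⟩))
      -- With `[0] = {0}` the conditions on `[0]` in `ω(+)` and `ω(-)` are empty; the sign of `k`
      -- decides which of the two descriptions applies.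
      have hempty : ∀ j : ℕ+, (j : ℤ) ∉ block r 0 := fun j hj => by
        have h1 := hr.mem_block.1 hj
        exact (hc (Sum.inl j)).elim h1.2 h1.1
      have hμ := (mem_cls.1 hlam.1).symm
      rcases k with i | i
      · exact Or.inl ⟨lam + ε i, ⟨hr.mem_R_iff.2 hstd, fun j hj => absurd hj (hempty j)⟩, i,
          self_mem_block r _, by simpa using hμ⟩
      · exact Or.inr (Or.inl ⟨lam - ε i, ⟨hr.mem_R_iff.2 (by simpa [sub_eq_add_neg] using hstd),
          fun j hj => absurd hj (hempty j)⟩, i, by simp [self_mem_block], by simpa using hμ⟩)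
  · rintro (⟨-, -, h⟩ | ⟨B, hB, -, h | h⟩ | ⟨B, hB, -, h | h⟩ | ⟨B₁, B₂, h1, h2, h | h | h⟩)
    · exact hR h
    · exact hr.exists_isExtremal_of_equivOmegaPlus hB h
    · exact hR h
    · exact hr.exists_isExtremal_of_equivOmegaMinus hB h
    · exact hR h
    · exact hr.exists_isExtremal_of_equivOmegaPlus h1 h
    · exact hr.exists_isExtremal_of_equivOmegaMinus h2 h
    · exact hR h

end IsAdmissibleOrder

/-! ### The monomial basis of `X_sp(μ)` -/

theorem mem_V {μ : ℕ+ → ℂ} {f : Fock} :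
    f ∈ V μ ↔ ∀ lam, f lam ≠ 0 → lam - μ ∈ rootLattice ∧ intPos μ ⊆ intPos lam := by
  change f ∈ Finsupp.supported ℂ ℂ _ ↔ _
  rw [Finsupp.mem_supported]
  exact ⟨fun h lam hl => h (Finsupp.mem_support_iff.2 hl),
    fun h lam hl => h lam (Finsupp.mem_support_iff.1 hl)⟩

theorem mono_mem_V {μ lam : ℕ+ → ℂ} :
    mono lam ∈ V μ ↔ lam - μ ∈ rootLattice ∧ intPos μ ⊆ intPos lam := by
  rw [mem_V]
  refine ⟨fun h => h lam (by simp [mono]), fun h lam' hl => ?_⟩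
  rw [mono, Finsupp.single_apply_ne_zero] at hl
  exact hl.1 ▸ h

theorem V_le_V {μ μ' : ℕ+ → ℂ} (h : mono μ' ∈ V μ) : V μ' ≤ V μ := by
  intro f hf
  rw [mono_mem_V] at h
  rw [mem_V] at hf ⊢
  exact fun lam hl => ⟨by simpa using add_mem (hf lam hl).1 h.1, h.2.trans (hf lam hl).2⟩

theorem mono_self_mem_V (μ : ℕ+ → ℂ) : mono μ ∈ V μ := mono_mem_V.2 ⟨by simp, subset_rfl⟩

/-- The coefficients of the monomials of the class of `μ`. -/
def coeffs (μ : ℕ+ → ℂ) : V μ →ₗ[ℂ] (cls μ →₀ ℂ) :=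
  (Finsupp.lsubtypeDomain (cls μ)).comp (V μ).toSubmodule.subtype

theorem coeffs_apply {μ : ℕ+ → ℂ} (f : V μ) (lam : cls μ) : coeffs μ f lam = f.1 lam.1 := rfl

theorem cls_mono_mem_V {μ lam : ℕ+ → ℂ} (h : lam ∈ cls μ) : mono lam ∈ V μ :=
  mono_mem_V.2 ⟨h.1, h.2.ge⟩

theorem coeffs_mono {μ lam : ℕ+ → ℂ} (h : lam ∈ cls μ) :
    coeffs μ ⟨mono lam, cls_mono_mem_V h⟩ = Finsupp.single ⟨lam, h⟩ 1 := by
  classical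
  ext lam'
  simp [coeffs_apply, mono, Finsupp.single_apply, Subtype.ext_iff]

theorem coeffs_surjective (μ : ℕ+ → ℂ) : Function.Surjective (coeffs μ) := by
  rw [← LinearMap.range_eq_top, eq_top_iff, ← Finsupp.supported_univ,
    Finsupp.supported_eq_span_single, Submodule.span_le]
  rintro _ ⟨lam, -, rfl⟩
  exact ⟨_, coeffs_mono lam.2⟩

/-- A proper `V_sp(μ')` contains no monomial of the class of `μ`: such a monomial would give
`Int⁺(μ') ⊆ Int⁺(μ)` and hence equality. Every monomial of `V_sp(μ)` outside the class generates a
proper `V_sp`. -/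
theorem Vplus_eq_ker (μ : ℕ+ → ℂ) : (Vplus μ).toSubmodule = LinearMap.ker (coeffs μ) := by
  apply le_antisymm
  · simp only [Vplus, LieSubmodule.iSup_toSubmodule]
    refine iSup₂_le fun μ' hμ' f hf => ?_
    have hf' : f.1 ∈ V μ' := hf
    rw [LinearMap.mem_ker]
    ext lam
    rw [coeffs_apply, Finsupp.zero_apply]
    by_contra hne
    have h1 := (mem_V.1 hf') _ hne
    have h2 := mono_mem_V.1 (hμ'.le (mono_self_mem_V μ'))
    refine hμ'.not_ge (V_le_V (mono_mem_V.2 ⟨by simpa using neg_mem h2.1, ?_⟩))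
    exact h1.2.trans lam.2.2.subset
  · intro f hf
    rw [LinearMap.mem_ker] at hf
    have h1 : f.1 ∈ Finsupp.supported ℂ ℂ {lam | mono lam ∈ V μ ∧ lam ∉ cls μ} := by
      rw [Finsupp.mem_supported]
      intro lam hl
      rw [Finset.mem_coe, Finsupp.mem_support_iff] at hl
      refine ⟨mono_mem_V.2 (mem_V.1 f.2 lam hl), fun hc => hl ?_⟩
      exact DFunLike.congr_fun hf ⟨lam, hc⟩
    have h2 : f.1 ∈ (Vplus μ).toSubmodule.map (V μ).toSubmodule.subtype := by
      rw [Finsupp.supported_eq_span_single] at h1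
      refine Submodule.span_le.2 ?_ h1
      rintro _ ⟨lam, ⟨hl, hc⟩, rfl⟩
      refine ⟨⟨mono lam, hl⟩, ?_, rfl⟩
      have hlt : V lam < V μ := by
        refine lt_of_le_of_ne (V_le_V hl) fun he => hc ?_
        have h3 := mono_mem_V.1 (he ▸ mono_self_mem_V μ : mono μ ∈ V lam)
        have h4 := mono_mem_V.1 hl
        exact ⟨h4.1, h3.2.antisymm h4.2⟩
      have h5 : (V lam).comap (V μ).incl ≤ Vplus μ :=
        le_iSup₂ (f := fun (μ' : ℕ+ → ℂ) (_ : V μ' < V μ) => (V μ').comap (V μ).incl) lam hlt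
      exact h5 (mono_self_mem_V lam)
    obtain ⟨g, hg, hgf⟩ := h2
    have : g = f := Subtype.ext hgf
    exact this ▸ hg

/-- The basis of `X_sp(μ)` of the images of the monomials of the class of `μ`. -/
def basisX (μ : ℕ+ → ℂ) : Module.Basis (cls μ) ℂ (Xsp μ) :=
  .ofRepr ((Submodule.quotEquivOfEq _ _ (Vplus_eq_ker μ)).trans
    ((coeffs μ).quotKerEquivOfSurjective (coeffs_surjective μ)))

theorem basisX_repr_mk {μ : ℕ+ → ℂ} (f : V μ) :
    (basisX μ).repr (LieSubmodule.Quotient.mk f) = coeffs μ f := rfl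

theorem basisX_apply {μ : ℕ+ → ℂ} (lam : cls μ) :
    basisX μ lam = LieSubmodule.Quotient.mk ⟨mono lam.1, cls_mono_mem_V lam.2⟩ := by
  rw [← (basisX μ).repr.injective.eq_iff, basisX_repr_mk, coeffs_mono, Module.Basis.repr_self]

theorem basisX_repr_lie {μ : ℕ+ → ℂ} (x : sp) (lam lam' : cls μ) :
    (basisX μ).repr ⁅x, basisX μ lam⁆ lam' = op x (mono lam.1) lam'.1 := by
  rw [basisX_apply]
  exact coeffs_apply ⁅x, (⟨mono lam.1, cls_mono_mem_V lam.2⟩ : V μ)⁆ lam'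

open Classical in
/-- The image of the monomial `x^λ` in `X_sp(μ)`, which is `0` if `λ` is not in the class of `μ`. -/
def vecX (μ lam : ℕ+ → ℂ) : Xsp μ := if h : lam ∈ cls μ then basisX μ ⟨lam, h⟩ else 0

theorem vecX_of_mem {μ lam : ℕ+ → ℂ} (h : lam ∈ cls μ) : vecX μ lam = basisX μ ⟨lam, h⟩ :=
  dif_pos h

theorem vecX_of_notMem {μ lam : ℕ+ → ℂ} (h : lam ∉ cls μ) : vecX μ lam = 0 := dif_neg h

theorem vecX_ne_zero {μ lam : ℕ+ → ℂ} (h : lam ∈ cls μ) : vecX μ lam ≠ 0 := by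
  rw [vecX_of_mem h]
  exact (basisX μ).ne_zero _

theorem lie_vecX {μ lam lam' : ℕ+ → ℂ} {x : sp} {c : ℂ} (hl : lam ∈ cls μ)
    (h : op x (mono lam) = c • mono lam') : ⁅x, vecX μ lam⁆ = c • vecX μ lam' := by
  classical
  rw [vecX_of_mem hl, ← (basisX μ).repr.injective.eq_iff]
  ext lam''
  rw [basisX_repr_lie, h]
  by_cases hl' : lam' ∈ cls μ
  · simp [vecX_of_mem hl', mono, Finsupp.single_apply, Subtype.ext_iff]
  · have : lam' ≠ lam''.1 := fun h => hl' (h ▸ lam''.2)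
    simp [vecX_of_notMem hl', mono, this]

theorem span_vecX (μ : ℕ+ → ℂ) : Submodule.span ℂ (vecX μ '' cls μ) = ⊤ := by
  rw [eq_top_iff, ← (basisX μ).span_eq]
  refine Submodule.span_mono ?_
  rintro _ ⟨lam, rfl⟩
  exact ⟨lam.1, lam.2, vecX_of_mem lam.2⟩

/-! ### Weights -/

theorem mem_wtSpace {L : Type*} [LieRing L] [LieAlgebra ℂ L] {t : ℕ+ → L} {M : Type*}
    [AddCommGroup M] [Module ℂ M] [LieRingModule L M] [LieModule ℂ L M] {ν : ℕ+ → ℂ} {m : M} :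
    m ∈ wtSpace t M ν ↔ ∀ i, ⁅t i, m⁆ = ν i • m := by
  simp [wtSpace]

theorem lie_mem_wtSpace {M : Type*} [AddCommGroup M] [Module ℂ M] [LieRingModule sp M]
    [LieModule ℂ sp M] {α ν : ℕ+ → ℂ} {x : sp} (hx : x ∈ rootSpace α) {m : M}
    (hm : m ∈ wtSpace h M ν) : ⁅x, m⁆ ∈ wtSpace h M (ν + α) := by
  rw [rootSpace, mem_wtSpace] at hx
  rw [mem_wtSpace] at hm ⊢
  intro i
  rw [leibniz_lie, hx, hm, smul_lie, lie_smul, ← add_smul, Pi.add_apply, add_comm]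

theorem h_apply (i : ℕ+) (v : NatRep) :
    (h i).1 v = v (Sum.inl i) • e (Sum.inl i) - v (Sum.inr i) • e (Sum.inr i) := by
  simp [h, e]

/-- The element `h i` acts by the symmetrised product `(x_i ∂_i + ∂_i x_i) / 2`, whence the shift by
`1 / 2` in all weights. -/
theorem op_h_mono (i : ℕ+) (lam : ℕ+ → ℂ) : op (h i) (mono lam) = (lam i + 1 / 2) • mono lam := by
  classical
  rw [op_eq_sum (h i) {Sum.inl i, Sum.inr i} fun a ha => ?_]
  · rw [Finset.sum_pair (by simp)]
    have h1 : (h i).1 (e (Sum.inl i)) = e (Sum.inl i) := by rw [h_apply]; simp [e]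
    have h2 : (h i).1 (e (Sum.inr i)) = dual (Sum.inl i) := by rw [h_apply]; simp [e, dual]
    rw [h1, h2, psi_dual, psi_e]
    simp only [Sum.elim_inl, Sum.elim_inr, coOp, LinearMap.smul_apply,
      LinearMap.add_apply, Module.End.mul_apply, mulX_mono, dX_mono, map_smul, sub_add_cancel,
      add_sub_cancel_right]
    rw [← add_smul, smul_smul]
    congr 1
    simp [ε]
    ring
  · by_contra hn
    simp only [Finset.mem_insert, Finset.mem_singleton, not_or] at hn
    refine ha ?_
    rw [h_apply]
    simp [e, Finsupp.single_eq_of_ne' hn.1, Finsupp.single_eq_of_ne' hn.2]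

theorem lie_h_vecX {μ : ℕ+ → ℂ} (i : ℕ+) (lam : ℕ+ → ℂ) :
    ⁅h i, vecX μ lam⁆ = (lam i + 1 / 2) • vecX μ lam := by
  by_cases hl : lam ∈ cls μ
  · exact lie_vecX hl (op_h_mono i lam)
  · simp [vecX_of_notMem hl]

theorem vecX_mem_wtSpace (μ lam : ℕ+ → ℂ) :
    vecX μ lam ∈ wtSpace h (Xsp μ) (lam + fun _ => 1 / 2) :=
  mem_wtSpace.2 fun i => lie_h_vecX i lam

theorem basisX_repr_lie_h {μ : ℕ+ → ℂ} (i : ℕ+) (m : Xsp μ) (lam : cls μ) :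
    (basisX μ).repr ⁅h i, m⁆ lam = (lam.1 i + 1 / 2) * (basisX μ).repr m lam := by
  classical
  suffices (basisX μ).coord lam ∘ₗ LieModule.toEnd ℂ sp (Xsp μ) (h i) =
      (lam.1 i + 1 / 2) • (basisX μ).coord lam from LinearMap.congr_fun this m
  refine (basisX μ).ext fun lam' => ?_
  rw [← vecX_of_mem lam'.2, LinearMap.comp_apply, LieModule.toEnd_apply_apply, lie_h_vecX,
    vecX_of_mem lam'.2, map_smul, LinearMap.smul_apply, Module.Basis.coord_apply,
    Module.Basis.repr_self, Finsupp.single_apply]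
  split_ifs with hl
  · rw [← hl]
  · simp

theorem wtSpace_Xsp_le (μ ν : ℕ+ → ℂ) :
    wtSpace h (Xsp μ) ν ≤ Submodule.span ℂ {vecX μ (ν - fun _ => 1 / 2)} := by
  intro m hm
  rw [mem_wtSpace] at hm
  have key : ∀ lam : cls μ, (basisX μ).repr m lam ≠ 0 → lam.1 = ν - fun _ => 1 / 2 := by
    intro lam hl
    funext i
    have h1 := basisX_repr_lie_h i m lam
    rw [hm, map_smul, Finsupp.smul_apply, smul_eq_mul] at h1
    have h2 := mul_right_cancel₀ hl h1
    rw [Pi.sub_apply, h2]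
    ring
  rw [← (basisX μ).linearCombination_repr m, Finsupp.linearCombination_apply]
  refine Submodule.sum_mem _ fun lam hl => Submodule.smul_mem _ _ ?_
  rw [← vecX_of_mem lam.2, key lam (Finsupp.mem_support_iff.1 hl)]
  exact Submodule.mem_span_singleton_self _

theorem isWeightModule_Xsp (μ : ℕ+ → ℂ) : IsWeightModule h (Xsp μ) := by
  refine ⟨?_, fun ν => ?_⟩
  · rw [eq_top_iff, ← span_vecX, Submodule.span_le]
    rintro _ ⟨lam, -, rfl⟩
    exact Submodule.mem_iSup_of_mem _ (vecX_mem_wtSpace μ lam)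
  · exact Submodule.finiteDimensional_of_le (wtSpace_Xsp_le μ ν)

/-- The target weight space is at most one-dimensional, so no explicit description of the root space
is needed. -/
theorem exists_lie_vecX {μ α : ℕ+ → ℂ} {x : sp} (hx : x ∈ rootSpace α) (lam : ℕ+ → ℂ) :
    ∃ c : ℂ, ⁅x, vecX μ lam⁆ = c • vecX μ (lam + α) := by
  have h1 := wtSpace_Xsp_le μ _ (lie_mem_wtSpace hx (vecX_mem_wtSpace μ lam))
  have h2 : (lam + fun _ => (1 / 2 : ℂ)) + α - (fun _ => 1 / 2) = lam + α := by abel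
  rw [h2] at h1
  obtain ⟨c, hc⟩ := Submodule.mem_span_singleton.1 h1
  exact ⟨c, hc.symm⟩

/-- A subspace stable under the Cartan subalgebra contains the monomials of its elements. -/
theorem vecX_mem_of_mem {μ : ℕ+ → ℂ} {W : Submodule ℂ (Xsp μ)}
    (hW : ∀ i, ∀ m ∈ W, ⁅h i, m⁆ ∈ W) {m : Xsp μ} (hm : m ∈ W) {lam : cls μ}
    (hl : (basisX μ).repr m lam ≠ 0) : vecX μ lam.1 ∈ W := by
  induction hn : ((basisX μ).repr m).support.card using Nat.strong_induction_on generalizing m with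
  | _ n ih =>
  subst hn
  by_cases hex : ∃ lam', lam' ≠ lam ∧ (basisX μ).repr m lam' ≠ 0
  · obtain ⟨lam', hne, hl'⟩ := hex
    obtain ⟨i, hi⟩ : ∃ i, lam'.1 i ≠ lam.1 i := by
      by_contra! hn
      exact hne (Subtype.ext (funext hn))
    -- Subtracting the eigenvalue of `lam'` removes `lam'` from the support, while the coefficient
    -- at `lam` is only multiplied by a nonzero number.
    have hrep : ∀ κ, (basisX μ).repr (⁅h i, m⁆ - (lam'.1 i + 1 / 2) • m) κ =
        (κ.1 i - lam'.1 i) * (basisX μ).repr m κ := fun κ => by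
      rw [map_sub, Finsupp.sub_apply, basisX_repr_lie_h, map_smul, Finsupp.smul_apply, smul_eq_mul]
      ring
    refine ih _ (Finset.card_lt_card ?_)
      (W.sub_mem (hW i m hm) (W.smul_mem (lam'.1 i + 1 / 2) hm)) ?_ rfl
    · refine (Finset.ssubset_iff_of_subset fun κ hκ => ?_).2 ⟨lam', by simpa using hl', ?_⟩
      · rw [Finsupp.mem_support_iff, hrep] at hκ
        exact Finsupp.mem_support_iff.2 (right_ne_zero_of_mul hκ)
      · rw [Finsupp.mem_support_iff, hrep, sub_self, zero_mul]; simp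
    · rw [hrep]
      exact mul_ne_zero (sub_ne_zero.2 hi.symm) hl
  · push Not at hex
    have h1 : m = (basisX μ).repr m lam • vecX μ lam.1 := by
      rw [← (basisX μ).repr.injective.eq_iff, map_smul, vecX_of_mem lam.2, Module.Basis.repr_self]
      ext κ
      rcases eq_or_ne κ lam with rfl | hκ
      · simp
      · simp [hex κ hκ, Finsupp.single_eq_of_ne hκ]
    rw [h1] at hm
    exact (W.smul_mem_iff hl).1 hm

theorem exists_vecX_mem {μ : ℕ+ → ℂ} {W : Submodule ℂ (Xsp μ)}
    (hW : ∀ i, ∀ m ∈ W, ⁅h i, m⁆ ∈ W) (h0 : W ≠ ⊥) : ∃ lam ∈ cls μ, vecX μ lam ∈ W := by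
  obtain ⟨m, hm, hm0⟩ := W.exists_mem_ne_zero_of_ne_bot h0
  obtain ⟨lam, hl⟩ := Finsupp.ne_iff.1 ((basisX μ).repr.map_ne_zero_iff.2 hm0)
  exact ⟨lam.1, lam.2, vecX_mem_of_mem hW hm hl⟩

/-! ### Root vectors -/

theorem form_skew (u v : NatRep) : form u v = -form v u := by
  induction u using Finsupp.induction_linear with
  | zero => simp
  | add f g hf hg => simp only [map_add, LinearMap.add_apply, hf, hg]; ring
  | single i x =>
    induction v using Finsupp.induction_linear with
    | zero => simp
    | add f g hf hg => simp only [map_add, LinearMap.add_apply, hf, hg]; ring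
    | single j y =>
      rcases i with i | i <;> rcases j with j | j <;> rcases eq_or_ne i j with hij | hij <;>
        simp [form, hij, mul_comm, eq_comm]

theorem form_e_ne {a b : Idx} (hb : b ≠ a.swap) : form (e a) (e b) = 0 := by
  rcases a with i | i <;> rcases b with j | j <;> simp_all [form, e]

/-- The element `v ↦ Ω(e_b, v) e_a + Ω(e_a, v) e_b` of `sp(∞)`. -/
def rootVec (a b : Idx) : sp :=
  ⟨(form (e b)).smulRight (e a) + (form (e a)).smulRight (e b), fun u v => by
    simp only [LinearMap.add_apply, LinearMap.smulRight_apply, map_add, map_smul,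
      LinearMap.smul_apply, smul_eq_mul]
    rw [form_skew u (e a), form_skew u (e b)]
    ring, by
    refine (Set.toFinite {a.swap, b.swap}).subset fun c hc => ?_
    by_contra hn
    simp only [Set.mem_insert_iff, Set.mem_singleton_iff, not_or] at hn
    exact hc (by simp [form_e_ne hn.1, form_e_ne hn.2])⟩

theorem rootVec_apply (a b : Idx) (v : NatRep) :
    (rootVec a b).1 v = form (e b) v • e a + form (e a) v • e b := rfl

/-- Under the identification of `sp(∞)` with the symmetric square of the natural module, `rootVec a
b` is the product of `e_a` and `e_b`. Expansion in the dual basis gives half the sum of the two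
orders of `psi (e a)` and `psi (e b)`, which commute here. -/
theorem op_rootVec {a b : Idx} (hb : b ≠ a.swap) : op (rootVec a b) = psi (e a) * psi (e b) := by
  classical
  obtain ⟨s, hs⟩ := exists_finset (rootVec a b)
  obtain ⟨s₁, hs₁⟩ := exists_expand (e a)
  obtain ⟨s₂, hs₂⟩ := exists_expand (e b)
  have h1 : s₁ ⊆ s ∪ s₁ ∪ s₂ := fun c hc => by simp [hc]
  have h2 : s₂ ⊆ s ∪ s₁ ∪ s₂ := fun c hc => by simp [hc]
  rw [op_eq_sum _ (s ∪ s₁ ∪ s₂) fun c hc => by simp [hs c hc]]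
  have h3 : ∀ u v : NatRep, ∑ c ∈ s ∪ s₁ ∪ s₂, form u (e c) • (psi v * coOp c) =
      psi v * psi (∑ c ∈ s ∪ s₁ ∪ s₂, form u (e c) • dual c) := fun u v => by
    simp only [map_sum, map_smul, psi_dual, Finset.mul_sum, mul_smul_comm]
  simp only [rootVec_apply, map_add, map_smul, add_mul, smul_mul_assoc, Finset.sum_add_distrib,
    h3, hs₁ _ h1, hs₂ _ h2]
  rw [psi_comm (e b) (e a), form_e_ne (by rintro rfl; simp at hb), zero_smul, add_zero,
    ← two_smul ℂ, smul_smul]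
  norm_num

theorem h_apply_e (i : ℕ+) (a : Idx) : (h i).1 (e a) = wt a i • e a := by
  rw [h_apply]
  rcases a with j | j <;> rcases eq_or_ne i j with rfl | hij <;>
    simp_all [e, ε, eq_comm]

theorem rootVec_mem_rootSpace (a b : Idx) : rootVec a b ∈ rootSpace (wt a + wt b) := by
  rw [rootSpace, mem_wtSpace]
  intro i
  refine Subtype.ext (LinearMap.ext fun v => ?_)
  have hsk : ∀ c : Idx, form (e c) ((h i).1 v) = -(wt c i * form (e c) v) := fun c => by
    have := (h i).2.1 (e c) v
    rw [h_apply_e, map_smul, LinearMap.smul_apply, smul_eq_mul] at this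
    linear_combination this
  change (h i).1 ((rootVec a b).1 v) - (rootVec a b).1 ((h i).1 v) =
    (wt a + wt b) i • (rootVec a b).1 v
  simp only [rootVec_apply, map_add, map_smul, hsk, h_apply_e, Pi.add_apply]
  module

theorem psi_e_mono (a : Idx) (lam : ℕ+ → ℂ) :
    ∃ c : ℂ, psi (e a) (mono lam) = c • mono (lam + wt a) ∧ (expo lam a ≠ -1 → c ≠ 0) := by
  rw [psi_e]
  rcases a with i | i
  · exact ⟨1, by simp [mulX_mono], by simp⟩
  · refine ⟨-lam i, by simp [dX_mono, sub_eq_add_neg], fun h h0 => h ?_⟩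
    rw [neg_eq_zero] at h0
    simp [h0]

theorem exists_lie_rootVec {μ lam : ℕ+ → ℂ} {a b : Idx} (hb : b ≠ a.swap) (hl : lam ∈ cls μ)
    (hl' : lam + wt a + wt b ∈ cls μ) :
    ∃ c : ℂ, c ≠ 0 ∧ ⁅rootVec a b, vecX μ lam⁆ = c • vecX μ (lam + wt a + wt b) := by
  -- In the product `psi (e a) * psi (e b)` the factor of `b` acts first, so the intermediate
  -- exponent is `lam + wt b`.
  rw [add_right_comm] at hl' ⊢
  obtain ⟨h1, h2⟩ := (add_mem_cls hl (by rintro rfl; simp at hb)).1 hl'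
  obtain ⟨c, hc, hc0⟩ := psi_e_mono b lam
  obtain ⟨d, hd, hd0⟩ := psi_e_mono a (lam + wt b)
  refine ⟨c * d, mul_ne_zero (hc0 h1) (hd0 h2), lie_vecX hl ?_⟩
  rw [op_rootVec hb, Module.End.mul_apply, hc, map_smul, hd, smul_smul]

/-- A nonzero submodule contains a monomial, and root vectors carry it with nonzero coefficients
along a chain of root moves to every other monomial of the class. -/
theorem isIrreducible_Xsp (μ : ℕ+ → ℂ) : LieModule.IsIrreducible ℂ sp (Xsp μ) := by
  have hμ : μ ∈ cls μ := ⟨by simp, rfl⟩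
  have : Nontrivial (Xsp μ) := ⟨_, _, vecX_ne_zero hμ⟩
  refine { exists_pair_ne := ⟨⊥, ⊤, bot_ne_top⟩, eq_bot_or_eq_top := fun W => ?_ }
  refine or_iff_not_imp_left.2 fun hW => ?_
  obtain ⟨lam, hl, hlW⟩ := exists_vecX_mem (W := W.toSubmodule) (fun i m hm => W.lie_mem hm)
    (fun h0 => hW (LieSubmodule.toSubmodule_eq_bot W |>.1 h0))
  rw [← LieSubmodule.toSubmodule_eq_top, eq_top_iff, ← span_vecX, Submodule.span_le]
  rintro _ ⟨lam', hl', rfl⟩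
  have hpath := rootStep_connected_of_mem_cls hl hl'
  clear hl'
  suffices lam' ∈ cls μ ∧ vecX μ lam' ∈ W from this.2
  induction hpath with
  | refl => exact ⟨hl, hlW⟩
  | @tail κ κ' _ hstep ih =>
    obtain ⟨a, b, hne, rfl, hint⟩ := hstep
    have hκ : κ + wt a + wt b ∈ cls μ :=
      (add_mem_cls ih.1 hne).2 ((intPos_add_wt_add_wt_iff hne).1 hint)
    obtain ⟨c, hc0, hc⟩ := exists_lie_rootVec hne ih.1 hκ
    refine ⟨hκ, (W.toSubmodule.smul_mem_iff hc0).1 ?_⟩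
    rw [← hc]
    exact W.lie_mem ih.2

/-! ### Induced modules -/

section InducedModules

variable {L : Type*} [LieRing L] [LieAlgebra ℂ L]

/-- By the universal property, the lift of the canonical map into this subalgebra, followed by the
inclusion, is the identity. -/
theorem adjoin_range_ι :
    Algebra.adjoin ℂ (Set.range (UniversalEnvelopingAlgebra.ι ℂ (L := L))) = ⊤ := by
  set B := Algebra.adjoin ℂ (Set.range (UniversalEnvelopingAlgebra.ι ℂ (L := L))) with hB
  let g : L →ₗ⁅ℂ⁆ B :=
    { toFun := fun x => ⟨UniversalEnvelopingAlgebra.ι ℂ x, Algebra.subset_adjoin ⟨x, rfl⟩⟩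
      map_add' := fun x y => Subtype.ext (map_add _ x y)
      map_smul' := fun c x => Subtype.ext (map_smul _ c x)
      map_lie' := fun {x y} => Subtype.ext (LieHom.map_lie _ x y) }
  have h1 : B.val.comp (UniversalEnvelopingAlgebra.lift ℂ g) = AlgHom.id ℂ _ := by
    refine UniversalEnvelopingAlgebra.hom_ext ℂ (LieHom.ext fun x => ?_)
    change (UniversalEnvelopingAlgebra.lift ℂ g (UniversalEnvelopingAlgebra.ι ℂ x)).1 = _
    rw [UniversalEnvelopingAlgebra.lift_ι_apply]
    rfl
  refine eq_top_iff.2 fun u _ => ?_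
  have h2 : (UniversalEnvelopingAlgebra.lift ℂ g u).1 = u := AlgHom.congr_fun h1 u
  rw [← h2]
  exact (UniversalEnvelopingAlgebra.lift ℂ g u).2

theorem enveloping_induction {P : UniversalEnvelopingAlgebra ℂ L → Prop}
    (u : UniversalEnvelopingAlgebra ℂ L) (ι : ∀ x, P (UniversalEnvelopingAlgebra.ι ℂ x))
    (algebraMap : ∀ c, P (algebraMap ℂ _ c)) (add : ∀ u v, P u → P v → P (u + v))
    (mul : ∀ u v, P u → P v → P (u * v)) : P u := by
  have hu : u ∈ Algebra.adjoin ℂ (Set.range (UniversalEnvelopingAlgebra.ι ℂ (L := L))) := by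
    rw [adjoin_range_ι]; trivial
  induction hu using Algebra.adjoin_induction with
  | mem _ hx => obtain ⟨x, rfl⟩ := hx; exact ι x
  | algebraMap c => exact algebraMap c
  | add _ _ _ _ hu hv => exact add _ _ hu hv
  | mul _ _ _ _ hu hv => exact mul _ _ hu hv

variable {p : LieSubalgebra ℂ L} {S : Type*} [AddCommGroup S] [Module ℂ S]
  [LieRingModule p S] [LieModule ℂ p S]

/-- The class of `u ⊗ s` in the induced module. -/
def indMk (p : LieSubalgebra ℂ L) [LieRingModule p S] [LieModule ℂ p S]
    (u : UniversalEnvelopingAlgebra ℂ L) (s : S) : Induced p S :=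
  (inducedRel p S).mkQ (TensorProduct.tmul ℂ u s)

theorem smul_indMk (u v : UniversalEnvelopingAlgebra ℂ L) (s : S) :
    u • indMk p v s = indMk p (u * v) s := by
  rw [indMk, indMk, ← smul_eq_mul, ← TensorProduct.smul_tmul', map_smul]
  rfl

theorem lie_indMk_one (x : p) (s : S) : ⁅x.1, indMk p 1 s⁆ = indMk p 1 ⁅x, s⁆ := by
  change UniversalEnvelopingAlgebra.ι ℂ x.1 • indMk p 1 s = _
  rw [smul_indMk]
  refine (Submodule.Quotient.eq (inducedRel p S)).2 (Submodule.subset_span ⟨1, UniversalEnvelopingAlgebra.ι ℂ x, s, ?_⟩)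
  rw [UniversalEnvelopingAlgebra.lift_ι_apply, UniversalEnvelopingAlgebra.lift_ι_apply]
  simp

theorem smul_mem_lieSubmodule (N : LieSubmodule ℂ L (Induced p S))
    (u : UniversalEnvelopingAlgebra ℂ L) {m : Induced p S} (hm : m ∈ N) : u • m ∈ N := by
  induction u using enveloping_induction generalizing m with
  | ι x => exact N.lie_mem (x := x) hm
  | algebraMap c => rw [algebraMap_smul]; exact N.smul_mem c hm
  | add u v hu hv => rw [add_smul]; exact N.add_mem (hu hm) (hv hm)
  | mul u v hu hv => rw [mul_smul]; exact hu (hv hm)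

/-- The elements `1 ⊗ s` generate the induced module, so a proper submodule misses one of them. -/
theorem exists_indMk_notMem {N : LieSubmodule ℂ L (Induced p S)} (hN : N ≠ ⊤) :
    ∃ s : S, indMk p 1 s ∉ N := by
  by_contra! hn
  refine hN (eq_top_iff.2 fun m _ => ?_)
  obtain ⟨z, rfl⟩ := (inducedRel p S).mkQ_surjective m
  induction z using TensorProduct.induction_on with
  | zero => rw [map_zero]; exact N.zero_mem
  | add x y hx hy => rw [map_add]; exact N.add_mem (hx trivial) (hy trivial)
  | tmul u s =>
    have := smul_mem_lieSubmodule N u (hn s)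
    rwa [smul_indMk, mul_one] at this

/-- Schur's argument: a nonzero map to a simple module is onto, and its kernel is maximal because
anything strictly larger has nonzero, hence full, image. -/
theorem exists_isCoatom_of_hom {M : Type*} [AddCommGroup M] [Module ℂ M] [LieRingModule L M]
    [LieModule.IsIrreducible ℂ L M] {I : Type*} [AddCommGroup I]
    [Module ℂ I] [LieRingModule L I] [LieModule ℂ L I] (F : I →ₗ⁅ℂ, L⁆ M) (hF : F ≠ 0) :
    ∃ N : LieSubmodule ℂ L I, IsCoatom N ∧ Nonempty (M ≃ₗ⁅ℂ, L⁆ (I ⧸ N)) := by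
  obtain ⟨x₀, hx₀⟩ : ∃ x, F x ≠ 0 := by
    by_contra! hn
    exact hF (LieModuleHom.ext hn)
  have hsurj : Function.Surjective F := by
    rw [← LieModuleHom.range_eq_top]
    refine (eq_bot_or_eq_top F.range).resolve_left fun h0 => hx₀ ?_
    have : F x₀ ∈ F.range := (F.mem_range _).2 ⟨x₀, rfl⟩
    rwa [h0, LieSubmodule.mem_bot] at this
  refine ⟨F.ker, ⟨fun h0 => hx₀ ?_, fun N hN => ?_⟩, ⟨?_⟩⟩
  · have : x₀ ∈ F.ker := h0 ▸ LieSubmodule.mem_top x₀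
    simpa using this
  · obtain ⟨hle, x, hx, hxk⟩ := SetLike.lt_iff_le_and_exists.1 hN
    have hmap : N.map F = ⊤ := by
      refine (eq_bot_or_eq_top _).resolve_left fun h0 => hxk ?_
      have : F x ∈ N.map F := LieSubmodule.mem_map_of_mem hx
      rw [h0, LieSubmodule.mem_bot] at this
      simpa using this
    refine eq_top_iff.2 fun y _ => ?_
    have hy : F y ∈ N.map F := hmap ▸ LieSubmodule.mem_top _
    obtain ⟨n, hn, hny⟩ := (LieSubmodule.mem_map _).1 hy
    have h1 : y - n ∈ F.ker := by simp [hny]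
    simpa using N.add_mem (hle h1) hn
  · let E : (I ⧸ F.ker) ≃ₗ[ℂ] M := (F : I →ₗ[ℂ] M).quotKerEquivOfSurjective hsurj
    have hE : ∀ (x : L) (m : I ⧸ F.ker), E ⁅x, m⁆ = ⁅x, E m⁆ := fun x m => by
      obtain ⟨z, rfl⟩ := LieSubmodule.Quotient.surjective_mk' F.ker m
      exact F.map_lie x z
    exact LieModuleEquiv.symm { E with map_lie' := fun {x m} => hE x m }

/-- A vector on which `p` acts as it does on `S`, in a module isomorphic to a nonzero quotient of
the induced module. -/
theorem exists_ne_zero_lie_eq_zero {M : Type*} [AddCommGroup M] [Module ℂ M]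
    [LieRingModule L M] {N : LieSubmodule ℂ L (Induced p S)} (hN : N ≠ ⊤)
    (E : M ≃ₗ⁅ℂ, L⁆ (Induced p S ⧸ N)) :
    ∃ m : M, m ≠ 0 ∧ ∀ x : p, (∀ s : S, ⁅x, s⁆ = 0) → ⁅x.1, m⁆ = 0 := by
  obtain ⟨s, hs⟩ := exists_indMk_notMem hN
  refine ⟨E.symm (LieSubmodule.Quotient.mk' N (indMk p 1 s)), fun h0 => ?_, fun x hx => ?_⟩
  · have h1 := congrArg E h0
    rw [LieModuleEquiv.apply_symm_apply] at h1
    exact hs ((LieSubmodule.Quotient.mk_eq_zero' (N := N)).1 (h1.trans (map_zero E.toLinearEquiv)))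
  · have h1 : ⁅x.1, indMk p 1 s⁆ = 0 := by
      rw [lie_indMk_one, hx, indMk, TensorProduct.tmul_zero]
      exact map_zero (inducedRel p S).mkQ
    have h2 := LieModuleHom.map_lie E.symm.toLieModuleHom x.1
      (LieSubmodule.Quotient.mk' N (indMk p 1 s))
    rw [← LieModuleHom.map_lie, h1, map_zero, map_zero] at h2
    exact h2.symm

/-! ### Frobenius reciprocity -/

variable {M : Type*} [AddCommGroup M] [Module ℂ M] [LieRingModule L M] [LieModule ℂ L M]

/-- The action of the enveloping algebra. -/
def envAct (L M : Type*) [LieRing L] [LieAlgebra ℂ L] [AddCommGroup M] [Module ℂ M]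
    [LieRingModule L M] [LieModule ℂ L M] :
    UniversalEnvelopingAlgebra ℂ L →ₐ[ℂ] Module.End ℂ M :=
  UniversalEnvelopingAlgebra.lift ℂ (LieModule.toEnd ℂ L M)

theorem envAct_ι (x : L) (m : M) :
    envAct L M (UniversalEnvelopingAlgebra.ι ℂ x) m = ⁅x, m⁆ := by
  rw [envAct, UniversalEnvelopingAlgebra.lift_ι_apply]
  rfl

/-- The map `u ⊗ s ↦ u f(s)`. -/
def tensorLift (f : S →ₗ[ℂ] M) :
    TensorProduct ℂ (UniversalEnvelopingAlgebra ℂ L) S →ₗ[ℂ] M :=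
  TensorProduct.lift (LinearMap.lcomp ℂ M f ∘ₗ (envAct L M).toLinearMap)

theorem tensorLift_tmul (f : S →ₗ[ℂ] M) (u : UniversalEnvelopingAlgebra ℂ L) (s : S) :
    tensorLift f (TensorProduct.tmul ℂ u s) = envAct L M u (f s) := by
  simp [tensorLift]

theorem tensorLift_smul (f : S →ₗ[ℂ] M) (u : UniversalEnvelopingAlgebra ℂ L)
    (z : TensorProduct ℂ (UniversalEnvelopingAlgebra ℂ L) S) :
    tensorLift f (u • z) = envAct L M u (tensorLift f z) := by
  induction z using TensorProduct.induction_on with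
  | zero => simp
  | add x y hx hy => rw [smul_add, map_add, map_add, map_add, hx, hy]
  | tmul v s =>
    rw [TensorProduct.smul_tmul', tensorLift_tmul, tensorLift_tmul, smul_eq_mul, map_mul,
      Module.End.mul_apply]

theorem tensorLift_eq_zero (f : S →ₗ[ℂ] M) (hf : ∀ (x : p) s, f ⁅x, s⁆ = ⁅x.1, f s⁆)
    {z : TensorProduct ℂ (UniversalEnvelopingAlgebra ℂ L) S} (hz : z ∈ inducedRel p S) :
    tensorLift f z = 0 := by
  induction hz using Submodule.span_induction with
  | zero => simp
  | add x y _ _ hx hy => rw [map_add, hx, hy, add_zero]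
  | smul u x _ hx => rw [tensorLift_smul, hx, map_zero]
  | mem x hx =>
    obtain ⟨u, v, s, rfl⟩ := hx
    rw [map_sub, tensorLift_tmul, tensorLift_tmul, map_mul, Module.End.mul_apply, sub_eq_zero]
    congr 1
    induction v using enveloping_induction generalizing s with
    | ι x =>
      rw [UniversalEnvelopingAlgebra.lift_ι_apply, UniversalEnvelopingAlgebra.lift_ι_apply]
      exact (envAct_ι x.1 (f s)).trans (hf x s).symm
    | algebraMap c => simp
    | add u v hu hv => simp only [map_add, LinearMap.add_apply, hu, hv]
    | mul u v hu hv => simp only [map_mul, Module.End.mul_apply, hu, hv]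

/-- The homomorphism from the induced module given by Frobenius reciprocity. -/
def inducedLift (f : S →ₗ[ℂ] M) (hf : ∀ (x : p) s, f ⁅x, s⁆ = ⁅x.1, f s⁆) :
    Induced p S →ₗ⁅ℂ, L⁆ M where
  -- The relations form a submodule over `U(L)`, while `M` is only a `ℂ`-module with an action of
  -- `L`; the map is descended additively and its compatibility with both actions is checked
  -- afterwards.
  toFun := QuotientAddGroup.lift (inducedRel p S).toAddSubgroup
    (tensorLift f).toAddMonoidHom fun _ hz => tensorLift_eq_zero f hf hz
  map_add' := map_add _
  map_smul' c m := by
    obtain ⟨z, rfl⟩ := (inducedRel p S).mkQ_surjective m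
    exact map_smul (tensorLift f) c z
  map_lie' {x m} := by
    obtain ⟨z, rfl⟩ := (inducedRel p S).mkQ_surjective m
    exact (tensorLift_smul f (UniversalEnvelopingAlgebra.ι ℂ x) z).trans (envAct_ι x _)

theorem inducedLift_indMk (f : S →ₗ[ℂ] M) (hf : ∀ (x : p) s, f ⁅x, s⁆ = ⁅x.1, f s⁆)
    (u : UniversalEnvelopingAlgebra ℂ L) (s : S) :
    inducedLift f hf (indMk p u s) = envAct L M u (f s) := tensorLift_tmul f u s

theorem exists_isCoatom_of_map [LieModule.IsIrreducible ℂ L M] (f : S →ₗ[ℂ] M)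
    (hf : ∀ (x : p) s, f ⁅x, s⁆ = ⁅x.1, f s⁆) {s : S} (hs : f s ≠ 0) :
    ∃ N : LieSubmodule ℂ L (Induced p S), IsCoatom N ∧ Nonempty (M ≃ₗ⁅ℂ, L⁆ (Induced p S ⧸ N)) := by
  refine exists_isCoatom_of_hom (inducedLift f hf) fun h0 => hs ?_
  have h1 := DFunLike.congr_fun h0 (indMk p 1 s)
  rwa [inducedLift_indMk, map_one] at h1

end InducedModules

/-! ### Singular vectors of aligned modules -/

theorem rootSpace_le_nilradical {r : ℤ → ℤ → Prop} {α : ℕ+ → ℂ} (hα : α ∈ posRoots r) {x : sp}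
    (hx : x ∈ rootSpace α) : x ∈ nilradical r :=
  LieSubalgebra.subset_lieSpan (Set.mem_biUnion hα hx)

theorem rootSpace_le_parabolic {r : ℤ → ℤ → Prop} {α : ℕ+ → ℂ}
    (hα : α ∈ posRoots r ∪ zeroRoots r) {x : sp} (hx : x ∈ rootSpace α) : x ∈ parabolic r :=
  LieSubalgebra.subset_lieSpan (Or.inr (Set.mem_biUnion hα hx))

theorem rootSpace_le_levi {r : ℤ → ℤ → Prop} {α : ℕ+ → ℂ} (hα : α ∈ zeroRoots r) {x : sp}
    (hx : x ∈ rootSpace α) : x ∈ levi r :=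
  LieSubalgebra.subset_lieSpan (Or.inr (Set.mem_biUnion hα hx))

theorem h_mem_levi (r : ℤ → ℤ → Prop) (i : ℕ+) : h i ∈ levi r :=
  LieSubalgebra.subset_lieSpan (Or.inl ⟨i, rfl⟩)

/-- The vectors killed by all positive root spaces. -/
def singular (r : ℤ → ℤ → Prop) (M : Type*) [AddCommGroup M] [Module ℂ M] [LieRingModule sp M]
    [LieModule ℂ sp M] : Submodule ℂ M where
  carrier := {m | ∀ α ∈ posRoots r, ∀ x ∈ rootSpace α, ⁅x, m⁆ = 0}
  add_mem' ha hb α hα x hx := by rw [lie_add, ha α hα x hx, hb α hα x hx, add_zero]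
  zero_mem' := by simp
  smul_mem' c m hm α hα x hx := by rw [lie_smul, hm α hα x hx, smul_zero]

theorem lie_h_mem_singular {r : ℤ → ℤ → Prop} {M : Type*} [AddCommGroup M] [Module ℂ M]
    [LieRingModule sp M] [LieModule ℂ sp M] (i : ℕ+) {m : M} (hm : m ∈ singular r M) :
    ⁅h i, m⁆ ∈ singular r M := by
  intro α hα x hx
  have h1 : ⁅h i, x⁆ = α i • x := mem_wtSpace.1 hx i
  rw [leibniz_lie, ← lie_skew, h1, neg_lie, smul_lie, hm α hα x hx]
  simp

theorem singular_ne_bot_of_isAligned {r : ℤ → ℤ → Prop} {M : Type} [AddCommGroup M] [Module ℂ M]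
    [LieRingModule sp M] [LieModule ℂ sp M] (hM : IsAligned r M) : singular r M ≠ ⊥ := by
  obtain ⟨-, -, S, _, _, _, _, -, hu, -, N, hN, ⟨E⟩⟩ := hM
  obtain ⟨m, hm, hkill⟩ := exists_ne_zero_lie_eq_zero hN.1 E
  refine (Submodule.ne_bot_iff _).2 ⟨m, fun α hα x hx => ?_, hm⟩
  exact hkill ⟨x, rootSpace_le_parabolic (Or.inl hα) hx⟩ (hu _ (rootSpace_le_nilradical hα hx))

/-- The singular vectors form a nonzero `h`-stable space, which therefore contains a monomial. A
positive root keeping its exponent in the class would have a root vector acting on it by a nonzero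
multiple. -/
theorem exists_isExtremal_of_isAligned {r : ℤ → ℤ → Prop} (hr : IsAdmissibleOrder r)
    {μ : ℕ+ → ℂ} (hX : IsAligned r (Xsp μ)) : ∃ lam, IsExtremal r μ lam := by
  obtain ⟨lam, hl, hlW⟩ := exists_vecX_mem (W := singular r (Xsp μ))
    (fun i m hm => lie_h_mem_singular i hm) (singular_ne_bot_of_isAligned hX)
  refine ⟨lam, hl, fun α hα hn => ?_⟩
  obtain ⟨a, b, hab, rfl⟩ := hr.mem_posRoots.1 hα
  rw [← add_assoc] at hn
  obtain ⟨c, hc0, hc⟩ := exists_lie_rootVec (hr.ne_swap_of_lt hab) hl hn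
  rw [hlW _ hα _ (rootVec_mem_rootSpace a b)] at hc
  exact smul_ne_zero hc0 (vecX_ne_zero hn) hc.symm

/-! ### The Levi component of a singular monomial -/

/-- A move by a root of the reductive component within the class of `μ`. -/
def LeviStep (r : ℤ → ℤ → Prop) (μ lam lam' : ℕ+ → ℂ) : Prop :=
  lam ∈ cls μ ∧ lam' ∈ cls μ ∧ lam' - lam ∈ zeroRoots r

/-- The exponents reached from `lam` by moves by roots of the reductive component. -/
def leviOrbit (r : ℤ → ℤ → Prop) (μ lam : ℕ+ → ℂ) : Set (ℕ+ → ℂ) :=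
  {lam' | Relation.ReflTransGen (LeviStep r μ) lam lam'}

theorem neg_mem_zeroRoots {r : ℤ → ℤ → Prop} {α : ℕ+ → ℂ} (h : α ∈ zeroRoots r) :
    -α ∈ zeroRoots r := by
  obtain ⟨a, b, hab, rfl⟩ := mem_roots_iff.1 h.1
  refine ⟨mem_roots_iff.2 ⟨a.swap, b.swap, fun he => hab ?_, ?_⟩, h.2.2, by simpa using h.2.1⟩
  · simpa using congrArg Sum.swap he
  · rw [wt_swap, wt_swap, neg_add]

theorem LeviStep.symm {r : ℤ → ℤ → Prop} {μ lam lam' : ℕ+ → ℂ} (h : LeviStep r μ lam lam') :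
    LeviStep r μ lam' lam :=
  ⟨h.2.1, h.1, by simpa using neg_mem_zeroRoots h.2.2⟩

instance (r : ℤ → ℤ → Prop) (μ : ℕ+ → ℂ) : Std.Symm (LeviStep r μ) := ⟨fun _ _ h => h.symm⟩

theorem isExtremal_of_mem_leviOrbit {r : ℤ → ℤ → Prop} (hr : IsAdmissibleOrder r)
    {μ lam lam' : ℕ+ → ℂ} (h : IsExtremal r μ lam) (hl : lam' ∈ leviOrbit r μ lam) :
    IsExtremal r μ lam' := by
  induction hl with
  | refl => exact h
  | @tail κ κ' _ hstep ih =>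
    obtain ⟨a, b, hne, hα, h1, h2⟩ := hr.exists_of_mem_zeroRoots hstep.2.2
    have hκ : κ' = κ + wt a + wt b := by rw [add_assoc, ← hα]; abel
    rw [hκ]
    exact hr.isExtremal_add_wt_add_wt ih hne h1 h2 (hκ ▸ hstep.2.1)

/-- The subspace of `X_sp(μ)` spanned by the monomials of `leviOrbit`. -/
def leviSpan (r : ℤ → ℤ → Prop) (μ lam : ℕ+ → ℂ) : Submodule ℂ (Xsp μ) :=
  Submodule.span ℂ (vecX μ '' leviOrbit r μ lam)

theorem vecX_mem_leviSpan {r : ℤ → ℤ → Prop} {μ lam lam' : ℕ+ → ℂ}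
    (h : lam' ∈ leviOrbit r μ lam) : vecX μ lam' ∈ leviSpan r μ lam :=
  Submodule.subset_span ⟨lam', h, rfl⟩

theorem lie_mem_of_forall_vecX {r : ℤ → ℤ → Prop} {μ lam : ℕ+ → ℂ} {W : Submodule ℂ (Xsp μ)}
    {x : sp} (hx : ∀ lam' ∈ leviOrbit r μ lam, ⁅x, vecX μ lam'⁆ ∈ W) {m : Xsp μ}
    (hm : m ∈ leviSpan r μ lam) : ⁅x, m⁆ ∈ W := by
  have hle : leviSpan r μ lam ≤ W.comap (LieModule.toEnd ℂ sp (Xsp μ) x) := by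
    refine Submodule.span_le.2 ?_
    rintro _ ⟨lam', hl', rfl⟩
    exact hx lam' hl'
  exact hle hm

section

variable {r : ℤ → ℤ → Prop} (hr : IsAdmissibleOrder r) {μ lam : ℕ+ → ℂ} (hl : IsExtremal r μ lam)

include hr hl

theorem lie_eq_zero_of_mem_posRoots {α : ℕ+ → ℂ} (hα : α ∈ posRoots r) {x : sp}
    (hx : x ∈ rootSpace α) {m : Xsp μ} (hm : m ∈ leviSpan r μ lam) : ⁅x, m⁆ = 0 := by
  rw [← Submodule.mem_bot ℂ]
  refine lie_mem_of_forall_vecX (fun lam' hl' => ?_) hm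
  obtain ⟨c, hc⟩ := exists_lie_vecX (μ := μ) hx lam'
  rw [hc, vecX_of_notMem ((isExtremal_of_mem_leviOrbit hr hl hl').2 α hα), smul_zero]
  exact zero_mem _

/-- It suffices to treat generators of `p(≺)`. A Levi root either stays in the orbit or leaves the
class, where the monomial is `0` in the quotient. -/
theorem lie_mem_leviSpan {x : sp} (hx : x ∈ parabolic r) {m : Xsp μ}
    (hm : m ∈ leviSpan r μ lam) : ⁅x, m⁆ ∈ leviSpan r μ lam := by
  induction hx using LieSubalgebra.lieSpan_induction generalizing m with
  | mem x hx =>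
    rcases hx with ⟨i, rfl⟩ | hx
    · refine lie_mem_of_forall_vecX (fun lam' hl' => ?_) hm
      rw [lie_h_vecX]
      exact Submodule.smul_mem _ _ (vecX_mem_leviSpan hl')
    · obtain ⟨α, hα | hα, hxα⟩ := Set.mem_iUnion₂.1 hx
      · rw [lie_eq_zero_of_mem_posRoots hr hl hα hxα hm]
        exact zero_mem _
      · refine lie_mem_of_forall_vecX (fun lam' hl' => ?_) hm
        obtain ⟨c, hc⟩ := exists_lie_vecX (μ := μ) hxα lam'
        rw [hc]
        refine Submodule.smul_mem _ _ ?_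
        by_cases hn : lam' + α ∈ cls μ
        · refine vecX_mem_leviSpan (Relation.ReflTransGen.tail hl'
            ⟨(isExtremal_of_mem_leviOrbit hr hl hl').1, hn, by simpa using hα⟩)
        · rw [vecX_of_notMem hn]
          exact zero_mem _
  | zero => rw [zero_lie]; exact zero_mem _
  | add x y _ _ hx hy => rw [add_lie]; exact add_mem (hx hm) (hy hm)
  | smul c x _ hx => rw [smul_lie]; exact Submodule.smul_mem _ _ (hx hm)
  | lie x y _ _ hx hy => rw [lie_lie]; exact sub_mem (hx (hy hm)) (hy (hx hm))

theorem lie_eq_zero_of_mem_nilradical {x : sp} (hx : x ∈ nilradical r) {m : Xsp μ}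
    (hm : m ∈ leviSpan r μ lam) : ⁅x, m⁆ = 0 := by
  induction hx using LieSubalgebra.lieSpan_induction generalizing m with
  | mem x hx =>
    obtain ⟨α, hα, hxα⟩ := Set.mem_iUnion₂.1 hx
    exact lie_eq_zero_of_mem_posRoots hr hl hα hxα hm
  | zero => rw [zero_lie]
  | add x y _ _ hx hy => rw [add_lie, hx hm, hy hm, add_zero]
  | smul c x _ hx => rw [smul_lie, hx hm, smul_zero]
  | lie x y _ _ hx hy => rw [lie_lie, hx hm, hy hm, lie_zero, lie_zero, sub_zero]

theorem leviOrbit_subset_cls : leviOrbit r μ lam ⊆ cls μ := fun _ h =>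
  (isExtremal_of_mem_leviOrbit hr hl h).1

/-- Linear independence of the monomials: a basis vector in the span of a set of basis vectors
belongs to that set. -/
theorem mem_leviOrbit_of_vecX_mem {lam' : ℕ+ → ℂ} (hl' : lam' ∈ cls μ)
    (h : vecX μ lam' ∈ leviSpan r μ lam) : lam' ∈ leviOrbit r μ lam := by
  have himg : vecX μ '' leviOrbit r μ lam =
      basisX μ '' {κ : cls μ | κ.1 ∈ leviOrbit r μ lam} := by
    ext m
    constructor
    · rintro ⟨κ, hκ, rfl⟩
      have hκ' := leviOrbit_subset_cls hr hl hκ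
      exact ⟨⟨κ, hκ'⟩, hκ, (vecX_of_mem hκ').symm⟩
    · rintro ⟨κ, hκ, rfl⟩
      exact ⟨κ.1, hκ, vecX_of_mem κ.2⟩
  rw [leviSpan, himg, vecX_of_mem hl', Module.Basis.mem_span_image, Module.Basis.repr_self,
    Finsupp.support_single _ one_ne_zero] at h
  simpa using h

/-- A nonzero subspace of `leviSpan` which is stable under `l(≺)` is all of it. -/
theorem leviSpan_le_of_stable {W : Submodule ℂ (Xsp μ)} (hW : W ≤ leviSpan r μ lam) (h0 : W ≠ ⊥)
    (hst : ∀ x ∈ levi r, ∀ m ∈ W, ⁅x, m⁆ ∈ W) : leviSpan r μ lam ≤ W := by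
  obtain ⟨κ, hκ, hκW⟩ := exists_vecX_mem (fun i => hst _ (h_mem_levi r i)) h0
  have hκ' := mem_leviOrbit_of_vecX_mem hr hl hκ (hW hκW)
  have key : ∀ κ', Relation.ReflTransGen (LeviStep r μ) κ κ' → vecX μ κ' ∈ W := by
    intro κ' hpath
    induction hpath with
    | refl => exact hκW
    | @tail ν ν' _ hstep ih =>
      obtain ⟨a, b, hne, hα, -, -⟩ := hr.exists_of_mem_zeroRoots hstep.2.2
      have hν : ν' = ν + wt a + wt b := by rw [add_assoc, ← hα]; abel
      obtain ⟨c, hc0, hc⟩ := exists_lie_rootVec hne hstep.1 (hν ▸ hstep.2.1)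
      rw [hν, ← W.smul_mem_iff hc0, ← hc]
      exact hst _ (rootSpace_le_levi (hα ▸ hstep.2.2) (rootVec_mem_rootSpace a b)) _ ih
  refine Submodule.span_le.2 ?_
  rintro _ ⟨κ', hκ'', rfl⟩
  -- Levi moves are reversible, so a path leads from `κ` back to `lam` and on to any other point of
  -- the orbit.
  exact key κ' ((Std.Symm.symm _ _ hκ').trans hκ'')

/-- The `p(≺)`-module spanned by the Levi orbit of a singular monomial. -/
def leviModule : LieSubmodule ℂ (parabolic r) (Xsp μ) where
  toSubmodule := leviSpan r μ lam
  lie_mem {x _} hm := lie_mem_leviSpan hr hl x.2 hm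

theorem isWeightModule_leviModule : IsWeightModule (hIn r) (leviModule hr hl) := by
  refine ⟨eq_top_iff.2 fun m _ => ?_, fun ν => ?_⟩
  · obtain ⟨m, hm⟩ := m
    have hm' : m ∈ leviSpan r μ lam := hm
    induction hm' using Submodule.span_induction with
    | mem x hx =>
      obtain ⟨κ, hκ, rfl⟩ := hx
      refine Submodule.mem_iSup_of_mem (κ + fun _ => 1 / 2) (mem_wtSpace.2 fun i => ?_)
      exact Subtype.ext (lie_h_vecX i κ)
    | zero => exact zero_mem _
    | add x y hx hy hx' hy' => exact add_mem (hx' hx trivial) (hy' hy trivial)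
    | smul c x hx hx' => exact Submodule.smul_mem _ c (hx' hx trivial)
  · have := (isWeightModule_Xsp μ).2 ν
    have hmaps : ∀ m ∈ wtSpace (hIn r) (leviModule hr hl) ν,
        (leviModule hr hl).toSubmodule.subtype m ∈ wtSpace h (Xsp μ) ν := fun m hm =>
      mem_wtSpace.2 fun i => congrArg Subtype.val (mem_wtSpace.1 hm i)
    refine FiniteDimensional.of_injective
      ((leviModule hr hl).toSubmodule.subtype.restrict hmaps) fun x y hxy => ?_
    have h1 := congrArg Subtype.val hxy
    exact Subtype.ext (Subtype.ext h1)

/-- The inducing module is the span of the Levi orbit of the extremal monomial. Its inclusion into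
`X_sp(μ)` is a nonzero `p(≺)`-map, which extends to the induced module; simplicity of `X_sp(μ)` does
the rest. -/
theorem isAligned_of_isExtremal : IsAligned r (Xsp μ) := by
  have := isIrreducible_Xsp μ
  have hmem : vecX μ lam ∈ leviModule hr hl := vecX_mem_leviSpan Relation.ReflTransGen.refl
  have hne := vecX_ne_zero hl.1
  refine ⟨this, isWeightModule_Xsp μ, leviModule hr hl, inferInstance, inferInstance,
    inferInstance, inferInstance, isWeightModule_leviModule hr hl, ?_, ⟨?_, ?_⟩, ?_⟩
  · exact fun x hx s => Subtype.ext (lie_eq_zero_of_mem_nilradical hr hl hx s.2)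
  · exact ⟨⟨vecX μ lam, hmem⟩, 0, fun h0 => hne (congrArg Subtype.val h0)⟩
  · intro W hW
    refine or_iff_not_imp_left.2 fun h0 => eq_top_iff.2 fun m _ => ?_
    have hle := leviSpan_le_of_stable hr hl
      (W := W.map (leviModule hr hl).toSubmodule.subtype) ?_ ?_ ?_ m.2
    · obtain ⟨m', hm', he⟩ := hle
      exact (Subtype.ext he : m' = m) ▸ hm'
    · rintro _ ⟨m, -, rfl⟩
      exact m.2
    · exact fun h1 => h0 (Submodule.map_injective_of_injective Subtype.val_injective
        (h1.trans (Submodule.map_bot _).symm))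
    · rintro x hx _ ⟨m, hm, rfl⟩
      have hle : levi r ≤ parabolic r := LieSubalgebra.lieSpan_mono
        (Set.union_subset_union_right _ (Set.biUnion_subset_biUnion_left Set.subset_union_right))
      exact ⟨_, hW ⟨x, hle hx⟩ hx m hm, rfl⟩
  · exact exists_isCoatom_of_map (leviModule hr hl).toSubmodule.subtype (fun x s => rfl)
      (s := ⟨vecX μ lam, hmem⟩) hne

end

theorem isAligned_Xsp_iff {r : ℤ → ℤ → Prop} (hr : IsAdmissibleOrder r) {μ : ℕ+ → ℂ} :
    IsAligned r (Xsp μ) ↔ ∃ lam, IsExtremal r μ lam :=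
  ⟨exists_isExtremal_of_isAligned hr, fun ⟨_, hl⟩ => isAligned_of_isExtremal hr hl⟩

end SpInfty

end

theorem mainTheorem3 (r : ℤ → ℤ → Prop) (hirr : ∀ i, ¬ r i i)
    (htrans : ∀ i j k, r i j → r j k → r i k) (hadm : SpInfty.IsAdmissible r)
    (hZ2 : SpInfty.IsZ2Linear r) (μ : ℕ+ → ℂ) :
    SpInfty.IsAligned r (SpInfty.Xsp μ) ↔
      ((¬ (∃ B, SpInfty.IsMaxBlock r (SpInfty.blocksBelow r) B) ∧
          ¬ (∃ B, SpInfty.IsMinBlock r (SpInfty.blocksAbove r) B) ∧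
          ∃ ω ∈ SpInfty.Rmu r μ, SpInfty.SpEquiv μ ω) ∨
        (∃ B, SpInfty.IsMaxBlock r (SpInfty.blocksBelow r) B ∧
          ¬ (∃ C, SpInfty.IsMinBlock r (SpInfty.blocksAbove r) C) ∧
          (SpInfty.EquivOmegaPlus r μ B ∨ ∃ ω ∈ SpInfty.Rmu r μ, SpInfty.SpEquiv μ ω)) ∨
        (∃ B, SpInfty.IsMinBlock r (SpInfty.blocksAbove r) B ∧
          ¬ (∃ C, SpInfty.IsMaxBlock r (SpInfty.blocksBelow r) C) ∧
          (SpInfty.EquivOmegaMinus r μ B ∨ ∃ ω ∈ SpInfty.Rmu r μ, SpInfty.SpEquiv μ ω)) ∨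
        (∃ B₁ B₂, SpInfty.IsMaxBlock r (SpInfty.blocksBelow r) B₁ ∧
          SpInfty.IsMinBlock r (SpInfty.blocksAbove r) B₂ ∧
          (SpInfty.EquivOmegaPlus r μ B₁ ∨ SpInfty.EquivOmegaMinus r μ B₂ ∨
            ∃ ω ∈ SpInfty.Rmu r μ, SpInfty.SpEquiv μ ω))) := by
  rw [SpInfty.isAligned_Xsp_iff ⟨hirr, htrans, hadm, hZ2⟩]
  exact SpInfty.IsAdmissibleOrder.exists_isExtremal_iff ⟨hirr, htrans, hadm, hZ2⟩
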